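/- **Setting.** Let $\alpha\in(0,2)$ and $a,b\in(0,\infty]$. Let $X_{12}$ be a complex random variable of variance $1$ and $X_{11}$ a real random variable with $$\lim_{t\to\infty}-t^{-\alpha}\log\mathbb P(|X_{12}|\ge t)=a,\qquad \lim_{t\to\infty}-t^{-\alpha}\log\mathbb P(|X_{11}|\ge t)=b .$$ If $a<\infty$, assume moreover that there are $t_0>0$ and a probability measure $\vartheta_a$ on the unit circle with $\mathbb P(X_{12}/|X_{12}|\in U,\ |X_{12}|\ge t)=\vartheta_a(U)\,\mathbb P(|X_{12}|\ge t)$ for all $t\ge t_0$ and all measurable $U$; likewise, if $b<\infty$, for $X_{11}$ with a probability measure $\vartheta_b$. (If $a=\infty$, resp. $b=\infty$, let $\vartheta_a$, resp. $\vartheta_b$, be any probability measure on the unit circle.) Put $S_a=\mathrm{supp}\,\vartheta_a$, $S_b=\mathrm{supp}\,\vartheta_b$. Throughout, $\infty\cdot 0=0$. **Networks.** A network $G=(V,\omega)$ is a countable set $V$ with weights $\omega:V^2\to\mathbb C$ such that $\omega(u,v)=\overline{\omega(v,u)}$ and $\deg(v)=\sum_u|\omega(v,u)|^2<\infty$ for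 all $u,v$. The distance $D(u,v)\in[0,\infty]$ is the infimum of $\big(\sum_{i=1}^k|\omega(u_{i-1},u_i)|^{-2}\big)^{1/2}$ over the paths $u=u_0,\dots,u_k=v$ with nonzero weights ($k\ge 0$). A rooted network $(G,o)$ is a network with all $D(u,v)$ finite and a distinguished vertex $o$; $\mathcal G_*$ is the set of rooted networks up to root- and weight-preserving bijections. Put $d_{\rm loc}((G_1,o_1),(G_2,o_2))=1/(1+T)$, where $T$ is the supremum of the $t>0$ for which there is a root-preserving bijection $\sigma$ between the sets of vertices at distance at most $t$ from the root with $|\omega_{G_1}(u,v)-\omega_{G_2}(\sigma u,\sigma v)|\le 1/t$ for all $u,v$ at distance at most $t$ from $o_1$. $\mathcal G_*$ carries the topology of $d_{\rm loc}$ (a set is open if it contains a $d_{\rm loc}$-ball around each of its points) and its Borel sets, and $\mathcal P(\mathcal G_*)$, the set of probability measures on it, carries weak convergence. An $n\times n$ hermitian matrix $H$ is a network on $\{1,\dots,n\}$, and $U(H)=\frac1n\sum_{v}\delta_{g(v)}$, where $g(v)$ is the class of the connected component of $v$ rooted at $v$. **Admissible sofic measures.** $\mathcal P_s(\mathcal G_*)$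 is the set of weak limits of $U(H_n)$, $n\to\infty$, where $H_n$ is an $n\times n$ hermitian matrix whose nonzero entries satisfy $H_{ij}/|H_{ij}|\in S_a$ for $i<j$ and $H_{ii}/|H_{ii}|\in S_b$. **Spectral measure.** For $0<\theta<1$ let $\chi_\theta(x)=\min(1,\max(0,(x-\theta)/\theta))$ and $\widetilde\chi_\theta(x)=\min(1,\max(0,\theta^{-2}-x))$. The truncation $g_\theta\in\mathcal G_*$ of the class $g$ of $(G,o)$ is the class of the component of $o$ in the network with weights $\omega_\theta(u,v)=\widetilde\omega_\theta(u,v)\,\chi_\theta(|\widetilde\omega_\theta(u,v)|)$, where $\widetilde\omega_\theta(u,v)=\omega(u,v)\,\widetilde\chi_\theta(\deg u\vee\deg v)$. These weights define a bounded self-adjoint operator $T_\theta e_v=\sum_u\omega_\theta(u,v)e_u$ on $\ell^2$; let $\mu_{T_\theta}^{o}$ be its spectral measure at $e_o$, i.e. the probability measure with $\int x^k\,d\mu_{T_\theta}^{o}=\langle e_o,T_\theta^k e_o\rangle$ for all $k\geq 0$. Let $\mu_{\rho_\theta}=\mathbb E_\rho\,\mu_{T_\theta}^{o}$. For $\rho\in\mathcal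 P_s(\mathcal G_*)$ let $\mu_\rho$ be the weak limit of $\mu_{\rho_\theta}$ as $\theta\to0$ if $\mathbb E_\rho\sum_v|\omega(o,v)|^\beta<\infty$ for some $\beta\in(0,2)$, and $\mu_\rho=\delta_0$ otherwise. **Rate function.** For $\rho\in\mathcal P_s(\mathcal G_*)$ and $\nu\in\mathcal P(\mathbb R)$, the probability measures on $\mathbb R$, let $$I(\rho)=b\,\mathbb E_\rho|\omega(o,o)|^\alpha+\frac a2\,\mathbb E_\rho\sum_{v\ne o}|\omega(o,v)|^\alpha,\qquad \Phi(\nu)=\inf\{I(\rho):\rho\in\mathcal P_s(\mathcal G_*),\ \mu_\rho=\nu\}\in[0,\infty],$$ and let $m_\alpha(\nu)=\int|x|^\alpha\,d\nu(x)\in[0,\infty]$. **Theorem.** (a) For every $\nu\in\mathcal P(\mathbb R)$, $\Phi(\nu)\ge\big(\frac a2\wedge b\big)\,m_\alpha(\nu)$. (b) If $S_b=\{-1,1\}$, then $\Phi(\nu)\le b\,m_\alpha(\nu)$ for every $\nu\in\mathcal P(\mathbb R)$. (c) If $S_b=\{-1,1\}$, then $\Phi(\nu)=\big(\frac a2\wedge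 b\big)\,m_\alpha(\nu)$ for every symmetric $\nu\in\mathcal P(\mathbb R)$. -/

import Mathlib

open MeasureTheory Filter Topology Relation
open scoped ENNReal

noncomputable section

namespace WignerLDP

/-! ### Hermitian locally finite networks -/

/-- A hermitian, locally finite network on the vertex set `V`. -/
structure Network (V : Type) where
  /-- the weight of an oriented edge; `ω v v` is the weight of the loop at `v` -/
  ω : V → V → ℂ
  herm : ∀ u v, ω u v = (starRingEnd ℂ) (ω v u)
  locFin : ∀ v, Summable fun u => ‖ω v u‖ ^ 2

namespace Network

variable {V V' : Type}

/-- The degree `deg v = ∑ᵤ |ω(v,u)|²`. -/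
def deg (N : Network V) (v : V) : ℝ := ∑' u, ‖N.ω v u‖ ^ 2

/-- `(p 0, …, p k)` is a path from `u` to `v`. -/
def IsPath (N : Network V) (u v : V) (k : ℕ) (p : ℕ → V) : Prop :=
  p 0 = u ∧ p k = v ∧ ∀ i < k, N.ω (p i) (p (i + 1)) ≠ 0

/-- The `ℓ²` length `(∑ᵢ |ω(pᵢ₋₁,pᵢ)|⁻²)^(1/2)` of the path `(p 0, …, p k)`. -/
def pathLength (N : Network V) (k : ℕ) (p : ℕ → V) : ℝ :=
  Real.sqrt (∑ i ∈ Finset.range k, (‖N.ω (p i) (p (i + 1))‖ ^ 2)⁻¹)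

/-- The distance `D(u,v)`: the infimum of the lengths of the paths from `u` to `v`
(`⊤` if there is none). -/
def D (N : Network V) (u v : V) : ℝ≥0∞ :=
  ⨅ (k : ℕ) (p : ℕ → V) (_ : N.IsPath u v k p), ENNReal.ofReal (N.pathLength k p)

theorem D_ne_top_iff_exists (N : Network V) (u v : V) :
    N.D u v ≠ ⊤ ↔ ∃ k p, N.IsPath u v k p := by
  unfold D
  simp [iInf_eq_top]

theorem D_ne_top_iff (N : Network V) (u v : V) :
    N.D u v ≠ ⊤ ↔ ReflTransGen (fun x y => N.ω x y ≠ 0) u v := by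
  rw [D_ne_top_iff_exists]
  constructor
  · rintro ⟨k, p, h0, hk, hs⟩
    subst h0 hk
    induction k with
    | zero => exact ReflTransGen.refl
    | succ k ih =>
      exact (ih fun i hi => hs i (by omega)).tail (hs k (by omega))
  · intro h
    induction h with
    | refl => exact ⟨0, fun _ => u, rfl, rfl, fun i hi => absurd hi (by omega)⟩
    | @tail b c _ hbc ih =>
      obtain ⟨k, p, h0, hk, hs⟩ := ih
      refine ⟨k + 1, fun i => if i ≤ k then p i else c, by simp [h0], by simp, ?_⟩
      intro i hi
      rcases Nat.lt_or_ge i k with h | h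
      · have h1 : i ≤ k := h.le
        have h2 : i + 1 ≤ k := h
        simpa [h1, h2] using hs i h
      · have h1 : i = k := by omega
        subst h1
        simpa [hk] using hbc

theorem D_self_ne_top (N : Network V) (v : V) : N.D v v ≠ ⊤ :=
  (N.D_ne_top_iff v v).2 ReflTransGen.refl

theorem ω_ne_zero_symm (N : Network V) {u v : V} (h : N.ω u v ≠ 0) : N.ω v u ≠ 0 := by
  rw [N.herm v u]
  simpa using h

theorem reach_symm (N : Network V) {u v : V}
    (h : ReflTransGen (fun x y => N.ω x y ≠ 0) u v) :
    ReflTransGen (fun x y => N.ω x y ≠ 0) v u := by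
  induction h with
  | refl => exact ReflTransGen.refl
  | tail _ hbc ih => exact ReflTransGen.head (N.ω_ne_zero_symm hbc) ih

/-- The network induced on a set of vertices. -/
def induce (N : Network V) (s : Set V) : Network s where
  ω u v := N.ω u v
  herm u v := N.herm u v
  locFin v := (N.locFin v).comp_injective Subtype.val_injective

/-- The network of a hermitian matrix. -/
def ofMatrix {n : ℕ} (H : Matrix (Fin n) (Fin n) ℂ) (hH : H.IsHermitian) :
    Network (Fin n) where
  ω := H
  herm i j := (hH.apply i j).symm
  locFin _ := Summable.of_finite

/-! ### Truncation -/

/-- `χ_θ`: equal to `0` on `[0,θ)`, to `(x - θ)/θ` on `[θ,2θ)` and to `1` on `[2θ,∞)`. -/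
def chi (θ x : ℝ) : ℝ := if x < θ then 0 else if x < 2 * θ then (x - θ) / θ else 1

/-- `χ̃_θ`: equal to `1` on `[0,θ⁻²-1)`, to `θ⁻² - x` on `[θ⁻²-1,θ⁻²)` and to `0` on
`[θ⁻²,∞)`. -/
def chiTilde (θ x : ℝ) : ℝ :=
  if x < (θ ^ 2)⁻¹ - 1 then 1 else if x < (θ ^ 2)⁻¹ then (θ ^ 2)⁻¹ - x else 0

theorem chi_mem {θ : ℝ} (hθ : 0 < θ) (x : ℝ) : 0 ≤ chi θ x ∧ chi θ x ≤ 1 := by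
  unfold chi
  split_ifs with h1 h2
  · simp
  · exact ⟨div_nonneg (by linarith) hθ.le, (div_le_one hθ).2 (by linarith)⟩
  · simp

theorem chiTilde_mem (θ x : ℝ) : 0 ≤ chiTilde θ x ∧ chiTilde θ x ≤ 1 := by
  unfold chiTilde
  split_ifs with h1 h2
  · simp
  · exact ⟨by linarith, by linarith⟩
  · simp

/-- The weights `ω̃_θ(u,v) = ω(u,v) χ̃_θ(deg u ∨ deg v)`. -/
def truncDeg (N : Network V) (θ : ℝ) (u v : V) : ℂ :=
  N.ω u v * (chiTilde θ (max (N.deg u) (N.deg v)) : ℂ)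

/-- The truncated network `G_θ`, with weights `ω_θ(u,v) = ω̃_θ(u,v) χ_θ(|ω̃_θ(u,v)|)`. -/
def trunc (N : Network V) (θ : Set.Ioo (0 : ℝ) 1) : Network V where
  ω u v := N.truncDeg θ u v * (chi θ ‖N.truncDeg θ u v‖ : ℂ)
  herm u v := by
    have h : N.truncDeg θ u v = (starRingEnd ℂ) (N.truncDeg θ v u) := by
      unfold truncDeg
      rw [map_mul, Complex.conj_ofReal, ← N.herm u v, max_comm]
    have h' : ‖N.truncDeg θ u v‖ = ‖N.truncDeg θ v u‖ := by rw [h, RCLike.norm_conj]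
    rw [map_mul, Complex.conj_ofReal, ← h, h']
  locFin v := by
    refine Summable.of_nonneg_of_le (fun _ => by positivity) (fun u => ?_) (N.locFin v)
    refine pow_le_pow_left₀ (norm_nonneg _) ?_ 2
    have h1 := chi_mem θ.2.1 ‖N.truncDeg θ v u‖
    have h2 := chiTilde_mem θ (max (N.deg v) (N.deg u))
    rw [norm_mul, Complex.norm_real, Real.norm_of_nonneg h1.1]
    refine (mul_le_of_le_one_right (norm_nonneg _) h1.2).trans ?_
    unfold truncDeg
    rw [norm_mul, Complex.norm_real, Real.norm_of_nonneg h2.1]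
    exact mul_le_of_le_one_right (norm_nonneg _) h2.2

/-! ### Spectral measures -/

open Classical in
/-- `μ` is the spectral measure at the vector `e_v` of the bounded operator `T` on `ℓ²(V)`
given by `T e_w = ∑ᵤ ω(u,w) e_u`: a probability measure with moments
`∫ x^k dμ = ⟨e_v, T^k e_v⟩`. -/
def IsSpectralMeasure (N : Network V) (v : V) (μ : Measure ℝ) : Prop :=
  IsProbabilityMeasure μ ∧
  ∃ T : lp (fun _ : V => ℂ) 2 →L[ℂ] lp (fun _ : V => ℂ) 2,
    (∀ u w : V, T (lp.single 2 w (1 : ℂ)) u = N.ω u w) ∧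
    ∀ k : ℕ, Integrable (fun x : ℝ => x ^ k) μ ∧
      ((∫ x, x ^ k ∂μ : ℝ) : ℂ) =
        inner ℂ (lp.single 2 v (1 : ℂ) : lp (fun _ : V => ℂ) 2)
          ((T ^ k) (lp.single 2 v (1 : ℂ)))

/-- An isomorphism between networks. -/
def IsIso (N : Network V) (N' : Network V') (σ : V ≃ V') : Prop :=
  ∀ u v, N'.ω (σ u) (σ v) = N.ω u v

theorem IsIso.symm {N : Network V} {N' : Network V'} {σ : V ≃ V'} (h : N.IsIso N' σ) :
    N'.IsIso N σ.symm := fun u v => by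
  rw [← h, σ.apply_symm_apply, σ.apply_symm_apply]

theorem IsIso.reach {N : Network V} {N' : Network V'} {σ : V ≃ V'} (h : N.IsIso N' σ)
    {u v : V} (huv : N.D u v ≠ ⊤) : N'.D (σ u) (σ v) ≠ ⊤ := by
  rw [D_ne_top_iff] at huv ⊢
  refine huv.lift σ fun a b hab => ?_
  change N'.ω (σ a) (σ b) ≠ 0
  rwa [h a b]

theorem IsIso.reach_iff {N : Network V} {N' : Network V'} {σ : V ≃ V'} (h : N.IsIso N' σ)
    {u v : V} : N.D u v ≠ ⊤ ↔ N'.D (σ u) (σ v) ≠ ⊤ :=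
  ⟨h.reach, fun h' => by simpa using h.symm.reach h'⟩

theorem IsIso.deg_eq {N : Network V} {N' : Network V'} {σ : V ≃ V'} (h : N.IsIso N' σ)
    (v : V) : N'.deg (σ v) = N.deg v := by
  unfold deg
  rw [← σ.tsum_eq]
  exact tsum_congr fun u => by rw [h v u]

theorem IsIso.trunc {N : Network V} {N' : Network V'} {σ : V ≃ V'} (h : N.IsIso N' σ)
    (θ : Set.Ioo (0 : ℝ) 1) : (N.trunc θ).IsIso (N'.trunc θ) σ := fun u v => by
  simp only [Network.trunc, truncDeg, h.deg_eq, h u v]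

end Network

/-! ### Rooted networks -/

/-- A rooted network: a connected, hermitian, locally finite network on a countable vertex set
with a distinguished vertex. -/
structure RootedNetwork : Type 1 where
  V : Type
  countable : Countable V
  net : Network V
  root : V
  connected : ∀ u v, net.D u v ≠ ⊤

/-- The connected component of `v`, rooted at `v`. -/
def Network.component {V : Type} [Countable V] (N : Network V) (v : V) : RootedNetwork where
  V := {u : V | N.D v u ≠ ⊤}
  countable := inferInstance
  net := N.induce {u : V | N.D v u ≠ ⊤}
  root := ⟨v, N.D_self_ne_top v⟩
  connected := by
    have key : ∀ u (hu : N.D v u ≠ ⊤),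
        ReflTransGen (fun x y => (N.induce {u : V | N.D v u ≠ ⊤}).ω x y ≠ 0)
          ⟨v, N.D_self_ne_top v⟩ ⟨u, hu⟩ := by
      intro u hu
      have h := (N.D_ne_top_iff v u).1 hu
      induction h with
      | refl => exact ReflTransGen.refl
      | @tail b c hb hbc ih =>
        exact (ih ((N.D_ne_top_iff v b).2 hb)).tail hbc
    rintro ⟨u, hu⟩ ⟨w, hw⟩
    rw [Network.D_ne_top_iff]
    exact (Network.reach_symm _ (key u hu)).trans (key w hw)

namespace RootedNetwork

/-- Rooted isomorphism. -/
def Iso (G G' : RootedNetwork) : Prop :=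
  ∃ σ : G.V ≃ G'.V, σ G.root = G'.root ∧ G.net.IsIso G'.net σ

instance isoSetoid : Setoid RootedNetwork where
  r := Iso
  iseqv :=
    { refl := fun _ => ⟨Equiv.refl _, rfl, fun _ _ => rfl⟩
      symm := by
        rintro G G' ⟨σ, h0, h⟩
        exact ⟨σ.symm, by rw [← h0, σ.symm_apply_apply], h.symm⟩
      trans := by
        rintro G G' G'' ⟨σ, h0, h⟩ ⟨τ, k0, k⟩
        exact ⟨σ.trans τ, by simp [h0, k0], fun u v => by
          rw [← h u v, ← k]; rfl⟩ }

/-- The vertices at distance at most `t` from the root. -/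
def ball (G : RootedNetwork) (t : ℝ) : Set G.V := {u | G.net.D G.root u ≤ ENNReal.ofReal t}

/-- There is a root preserving bijection between the balls of radius `t` along which the weights
differ by at most `1/t`. -/
def Close (G G' : RootedNetwork) (t : ℝ) : Prop :=
  ∃ σ : G.ball t ≃ G'.ball t,
    (∀ u : G.ball t, (u : G.V) = G.root → (σ u : G'.V) = G'.root) ∧
    ∀ u v : G.ball t, ‖G.net.ω u v - G'.net.ω (σ u) (σ v)‖ ≤ 1 / t

/-- The supremum `T ∈ [0,∞]` of the radii `t > 0` at which two rooted networks are close. -/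
def agreement (G G' : RootedNetwork) : ℝ≥0∞ :=
  ⨆ (t : ℝ) (_ : 0 < t ∧ G.Close G' t), ENNReal.ofReal t

/-- The local distance `d_loc = 1/(1+T)`. -/
def dLoc (G G' : RootedNetwork) : ℝ≥0∞ := 1 / (1 + G.agreement G')

/-- The local topology: a set is open when it contains a `d_loc`-ball around each of its points.
The convergent sequences are tested through `d_loc(Gₙ,G) → 0`. -/
instance localTopology : TopologicalSpace RootedNetwork where
  IsOpen U := ∀ G ∈ U, ∃ ε : ℝ≥0∞, 0 < ε ∧ ∀ G', G.dLoc G' < ε → G' ∈ U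
  isOpen_univ := fun _ _ => ⟨1, one_pos, fun _ _ => trivial⟩
  isOpen_inter := by
    rintro U W hU hW G ⟨h1, h2⟩
    obtain ⟨ε, hε, h⟩ := hU G h1
    obtain ⟨δ, hδ, k⟩ := hW G h2
    exact ⟨min ε δ, lt_min hε hδ, fun G' hG' =>
      ⟨h G' (hG'.trans_le (min_le_left _ _)), k G' (hG'.trans_le (min_le_right _ _))⟩⟩
  isOpen_sUnion := by
    rintro S hS G ⟨U, hU, hG⟩
    obtain ⟨ε, hε, h⟩ := hS U hU G hG
    exact ⟨ε, hε, fun G' hG' => ⟨U, hU, h G' hG'⟩⟩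

/-- The truncation of a rooted network: the component of the root in `G_θ`. -/
def trunc (θ : Set.Ioo (0 : ℝ) 1) (G : RootedNetwork) : RootedNetwork :=
  haveI := G.countable
  (G.net.trunc θ).component G.root

/-- `ψ(G,o) = |ω(o,o)|^α`. -/
def psi (α : ℝ) (G : RootedNetwork) : ℝ≥0∞ := ‖G.net.ω G.root G.root‖ₑ ^ α

/-- `φ(G,o) = ½ ∑_{v ≠ o} |ω(o,v)|^α`. -/
def phi (α : ℝ) (G : RootedNetwork) : ℝ≥0∞ :=
  (∑' v : {v : G.V // v ≠ G.root}, ‖G.net.ω G.root v‖ₑ ^ α) / 2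

/-- `ξ_β(G,o) = ∑ᵥ |ω(o,v)|^β`. -/
def xi (β : ℝ) (G : RootedNetwork) : ℝ≥0∞ := ∑' v : G.V, ‖G.net.ω G.root v‖ₑ ^ β

theorem trunc_iso (θ : Set.Ioo (0 : ℝ) 1) {G G' : RootedNetwork} (h : Iso G G') :
    Iso (G.trunc θ) (G'.trunc θ) := by
  obtain ⟨σ, h0, h⟩ := h
  have ht := h.trunc θ
  refine ⟨σ.subtypeEquiv fun u => ?_, Subtype.ext h0, fun u v => ht u.1 v.1⟩
  exact ht.reach_iff.trans (by rw [h0]; rfl)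

theorem psi_iso (α : ℝ) {G G' : RootedNetwork} (h : Iso G G') : psi α G = psi α G' := by
  obtain ⟨σ, h0, h⟩ := h
  unfold psi
  rw [← h0, h]

theorem phi_iso (α : ℝ) {G G' : RootedNetwork} (h : Iso G G') : phi α G = phi α G' := by
  obtain ⟨σ, h0, h⟩ := h
  unfold phi
  congr 1
  have e : ∀ v, v ≠ G.root ↔ σ v ≠ G'.root := fun v => by rw [← h0, σ.injective.ne_iff]
  rw [← (σ.subtypeEquiv e).tsum_eq]
  refine tsum_congr fun v => ?_
  rw [← h, h0]
  rfl

theorem xi_iso (β : ℝ) {G G' : RootedNetwork} (h : Iso G G') : xi β G = xi β G' := by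
  obtain ⟨σ, h0, h⟩ := h
  unfold xi
  rw [← σ.tsum_eq]
  exact tsum_congr fun v => by rw [← h0, h]

end RootedNetwork

/-! ### The space `𝒢_*` of rooted networks up to isomorphism -/

/-- Isomorphism classes of rooted networks, with the local topology (as a quotient) and its Borel
sets. -/
def GStar : Type 1 := Quotient RootedNetwork.isoSetoid

namespace GStar

/-- The class of a rooted network. -/
def mk (G : RootedNetwork) : GStar := Quotient.mk _ G

instance : TopologicalSpace GStar :=
  inferInstanceAs (TopologicalSpace (Quotient RootedNetwork.isoSetoid))

instance : MeasurableSpace GStar := borel GStar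

instance : BorelSpace GStar := ⟨rfl⟩

/-- The truncation `g ↦ g_θ`. -/
def trunc (θ : Set.Ioo (0 : ℝ) 1) : GStar → GStar :=
  Quotient.lift (fun G => mk (G.trunc θ))
    fun _ _ h => Quotient.sound (RootedNetwork.trunc_iso θ h)

/-- `ψ` on `𝒢_*`. -/
def psi (α : ℝ) : GStar → ℝ≥0∞ :=
  Quotient.lift (RootedNetwork.psi α) fun _ _ h => RootedNetwork.psi_iso α h

/-- `φ` on `𝒢_*`. -/
def phi (α : ℝ) : GStar → ℝ≥0∞ :=
  Quotient.lift (RootedNetwork.phi α) fun _ _ h => RootedNetwork.phi_iso α h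

/-- `ξ_β` on `𝒢_*`. -/
def xi (β : ℝ) : GStar → ℝ≥0∞ :=
  Quotient.lift (RootedNetwork.xi β) fun _ _ h => RootedNetwork.xi_iso β h

/-- `μ` is the spectral measure at the root of (any representative of) `g`. -/
def IsSpectralMeasure (g : GStar) (μ : Measure ℝ) : Prop :=
  ∃ G : RootedNetwork, mk G = g ∧ G.net.IsSpectralMeasure G.root μ

open Classical in
/-- The spectral measure at the root of `g`. It exists and is unique when `g` is a truncated
network, the only case in which it is used; the value is `δ₀` where there is none. -/
def spectralMeasure (g : GStar) : Measure ℝ :=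
  if h : ∃ μ, g.IsSpectralMeasure μ then h.choose else Measure.dirac 0

end GStar

/-! ### Sofic measures -/

/-- The law `U(G)` of the rooted component of a uniformly chosen vertex of a finite network. -/
def unifRooted {V : Type} [Fintype V] [Nonempty V] (N : Network V) :
    ProbabilityMeasure GStar :=
  ⟨(Fintype.card V : ℝ≥0∞)⁻¹ • ∑ v : V, Measure.dirac (GStar.mk (N.component v)), ⟨by
    simp [ENNReal.inv_mul_cancel]⟩⟩

/-- The hermitian matrices `H` such that `H i j = 0` or `H i j / |H i j| ∈ Sa` for `i < j`, and
`H i i = 0` or `H i i / |H i i| ∈ Sb`. -/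
def admissible (Sa Sb : Set ℂ) (n : ℕ) : Set (Matrix (Fin n) (Fin n) ℂ) :=
  {H | H.IsHermitian ∧ (∀ i j, i < j → H i j = 0 ∨ H i j / (‖H i j‖ : ℂ) ∈ Sa) ∧
    ∀ i, H i i = 0 ∨ H i i / (‖H i i‖ : ℂ) ∈ Sb}

/-- The admissible sofic measures: local weak limits of `U(Hₙ)` with `Hₙ` an admissible
`n × n` matrix, `n ≥ 1`. -/
def IsAdmissibleSofic (Sa Sb : Set ℂ) (ρ : ProbabilityMeasure GStar) : Prop :=
  ∃ (H : (n : ℕ) → Matrix (Fin (n + 1)) (Fin (n + 1)) ℂ)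
    (hH : ∀ n, H n ∈ admissible Sa Sb (n + 1)),
    Tendsto (fun n => unifRooted (Network.ofMatrix (H n) (hH n).1)) atTop (𝓝 ρ)

/-! ### The spectral measure of a random rooted network -/

/-- `μ_{ρ_θ} = 𝔼_ρ μ^o_{T_θ}`, the mean spectral measure at the root of the truncated network. -/
def truncSpectral (ρ : ProbabilityMeasure GStar) (θ : Set.Ioo (0 : ℝ) 1) : Measure ℝ :=
  (ρ : Measure GStar).bind fun g => (g.trunc θ).spectralMeasure

/-- `μ_{ρ_θ}` converges weakly to `μ` as `θ → 0`. -/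
def IsSpectralLimit (ρ : ProbabilityMeasure GStar) (μ : ProbabilityMeasure ℝ) : Prop :=
  ∀ f : BoundedContinuousFunction ℝ ℝ,
    Tendsto (fun θ : Set.Ioo (0 : ℝ) 1 => ∫ x, f x ∂(truncSpectral ρ θ))
      (comap (fun θ : Set.Ioo (0 : ℝ) 1 => (θ : ℝ)) (𝓝[>] 0)) (𝓝 (∫ x, f x ∂(μ : Measure ℝ)))

open Classical in
/-- The spectral measure `μ_ρ`: the weak limit of `μ_{ρ_θ}` as `θ → 0` if `𝔼_ρ ξ_β < ∞` for some
`β ∈ (0,2)`, and `δ₀` otherwise. -/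
def spectral (ρ : ProbabilityMeasure GStar) : ProbabilityMeasure ℝ :=
  if h : (∃ β : ℝ, 0 < β ∧ β < 2 ∧ ∫⁻ g, g.xi β ∂(ρ : Measure GStar) < ⊤) ∧
      ∃ μ, IsSpectralLimit ρ μ
  then h.2.choose else ⟨Measure.dirac 0, inferInstance⟩

/-! ### The rate functions -/

open Classical in
/-- The rate function on random networks: `I(ρ) = b 𝔼_ρ ψ + a 𝔼_ρ φ` for admissible sofic `ρ`
(with `∞ · 0 = 0`), and `∞` otherwise. -/
def rateI (α : ℝ) (a b : ℝ≥0∞) (Sa Sb : Set ℂ) (ρ : ProbabilityMeasure GStar) : ℝ≥0∞ :=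
  if IsAdmissibleSofic Sa Sb ρ then
    b * ∫⁻ g, g.psi α ∂(ρ : Measure GStar) + a * ∫⁻ g, g.phi α ∂(ρ : Measure GStar)
  else ⊤

/-- `Φ(ν) = inf {I(ρ) : ρ admissible sofic, μ_ρ = ν}`. -/
def ratePhi (α : ℝ) (a b : ℝ≥0∞) (Sa Sb : Set ℂ) (ν : ProbabilityMeasure ℝ) : ℝ≥0∞ :=
  ⨅ (ρ : ProbabilityMeasure GStar) (_ : IsAdmissibleSofic Sa Sb ρ ∧ spectral ρ = ν),
    rateI α a b Sa Sb ρ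

/-! ### Moments, tails -/

/-- The absolute moment `m_α(ν) = ∫ |x|^α dν`. -/
def absMoment (α : ℝ) (ν : ProbabilityMeasure ℝ) : ℝ≥0∞ :=
  ∫⁻ x, ‖x‖ₑ ^ α ∂(ν : Measure ℝ)

/-- The complex random variable `Y` belongs to the class `𝒮_α(a)`, `a ∈ (0,∞]`, with angular law
`ϑ` on the unit circle: `-t^(-α) log ℙ(|Y| ≥ t) → a` as `t → ∞` and, when `a < ∞`, the modulus and
the argument of `Y` are independent for large values of the modulus, the argument having law `ϑ`
there. For `a = ∞` only the tail condition is required of `Y`. -/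
def TailClass {Ω : Type*} [MeasurableSpace Ω] (P : Measure Ω) (α : ℝ) (a : ℝ≥0∞)
    (ϑ : Measure ℂ) (Y : Ω → ℂ) : Prop :=
  Tendsto (fun t : ℝ => -((t ^ (-α) : ℝ) : EReal) * ENNReal.log (P {ω | t ≤ ‖Y ω‖})) atTop
    (𝓝 (a : EReal)) ∧
  (a ≠ ⊤ → ∃ t₀ : ℝ, 0 < t₀ ∧ ∀ t, t₀ ≤ t → ∀ U : Set ℂ, MeasurableSet U →
    P {ω | Y ω / (‖Y ω‖ : ℂ) ∈ U ∧ t ≤ ‖Y ω‖} = ϑ U * P {ω | t ≤ ‖Y ω‖})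

end WignerLDP

end

open WignerLDP

open scoped BoundedContinuousFunction

/-! Lower bound. If `T` is the operator of a network and `μ` its spectral measure at the root `o`,
then `∫ x² dμ = ‖T e_o‖² = ∑ᵥ |ω(o,v)|²`. Since `α ≤ 2`, monotonicity of `Lᵖ` norms and
subadditivity of `t ↦ t^(α/2)` give `∫ |x|^α dμ ≤ ∑ᵥ |ω(o,v)|^α = ξ_α`
(`Network.IsSpectralMeasure.lintegral_rpow_le`). Truncation only shrinks weights, so averaging over
`ρ` and letting `θ → 0` yields `m_α(μ_ρ) ≤ 𝔼ψ + 2𝔼φ` (`absMoment_le_of_isSpectralLimit`). The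
coefficients of `b 𝔼ψ + a 𝔼φ` dominate those of `(a/2 ∧ b)(𝔼ψ + 2𝔼φ)`. When `μ_ρ` is the default
`δ₀`, its moment is zero.

Upper bounds. Take numbers `xᵢ` whose empirical measures converge to `ν`. Diagonal matrices with
entries `xᵢ` converge to a single vertex carrying a loop of law `ν`, with mean spectral measure `ν`
and cost `b m_α(ν)`. If `ν` is symmetric and `z ∈ S_a`, two by two blocks with zero diagonal and
off-diagonal entries `z|xᵢ|` and its conjugate have eigenvalues `±|xᵢ|`, each of mass one half at
either vertex. The mean spectral measure is again `ν`, at cost `(a/2) m_α(ν)`, because each vertex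
sees one edge.

Both constructions live in one family, `twoPointClass (s, w)`: two vertices with equal loops `s` and
an edge `w`. This family is stable under truncation, and its spectral measure at the root is
`½(δ_{s+|w|} + δ_{s-|w|})`. The delicate point is measurability, since `GStar.spectralMeasure` is
defined by choice. It is settled by showing that `twoPointClass` is a closed embedding of `ℝ × ℂ` in
`𝒢_*`, so that measurability need only be checked in the coordinates `(s, w)`. -/

namespace WignerLDP

/-! ### Empirical measures on the line -/

/-- The empirical measure of `x 0, …, x n`. -/
noncomputable def empirical {X : Type*} [MeasurableSpace X] (x : ℕ → X) (n : ℕ) :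
    ProbabilityMeasure X :=
  ⟨((n + 1 : ℕ) : ℝ≥0∞)⁻¹ • ∑ i ∈ Finset.range (n + 1), Measure.dirac (x i), ⟨by
    simp only [Measure.smul_apply, Measure.coe_finsetSum, Finset.sum_apply, measure_univ,
      Finset.sum_const, Finset.card_range, nsmul_eq_mul, smul_eq_mul, mul_one]
    exact ENNReal.inv_mul_cancel (by simp) (ENNReal.natCast_ne_top _)⟩⟩

theorem integral_empirical {X : Type*} [MeasurableSpace X] [TopologicalSpace X]
    [OpensMeasurableSpace X] (x : ℕ → X) (n : ℕ) (f : X →ᵇ ℝ) :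
    ∫ y, f y ∂(empirical x n : Measure X) =
      (∑ i ∈ Finset.range (n + 1), f (x i)) / ((n + 1 : ℕ) : ℝ) := by
  have hf : StronglyMeasurable f := f.continuous.measurable.stronglyMeasurable
  change ∫ y, f y ∂(((n + 1 : ℕ) : ℝ≥0∞)⁻¹ • ∑ i ∈ Finset.range (n + 1), Measure.dirac (x i)) = _
  rw [integral_smul_measure, integral_finsetSum_measure]
  · simp only [integral_dirac' _ _ hf]
    rw [ENNReal.toReal_inv, ENNReal.toReal_natCast, smul_eq_mul, div_eq_inv_mul]
  · exact fun i _ => f.integrable _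

theorem empirical_real_apply {X : Type*} [MeasurableSpace X] (x : ℕ → X) (n : ℕ)
    {s : Set X} (hs : MeasurableSet s) :
    ((empirical x n : Measure X)).real s =
      (∑ i ∈ Finset.range (n + 1), s.indicator (fun _ => (1 : ℝ)) (x i)) / ((n + 1 : ℕ) : ℝ) := by
  have h : ((empirical x n : Measure X)) s =
      ((n + 1 : ℕ) : ℝ≥0∞)⁻¹ * ∑ i ∈ Finset.range (n + 1), s.indicator 1 (x i) := by
    change (((n + 1 : ℕ) : ℝ≥0∞)⁻¹ • ∑ i ∈ Finset.range (n + 1), Measure.dirac (x i)) s = _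
    simp [Measure.dirac_apply' _ hs]
  rw [Measure.real, h, ENNReal.toReal_mul, ENNReal.toReal_inv, ENNReal.toReal_natCast,
    ENNReal.toReal_sum, div_eq_inv_mul]
  · congr 1
    refine Finset.sum_congr rfl fun i _ => ?_
    by_cases hi : x i ∈ s <;> simp [hi]
  · intro i _
    by_cases hi : x i ∈ s <;> simp [hi]

/-- Every probability measure on the line is the weak limit of the empirical measures of some
sequence. -/
theorem exists_tendsto_empirical (ν : ProbabilityMeasure ℝ) :
    ∃ x : ℕ → ℝ, Tendsto (empirical x) atTop (𝓝 ν) := by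
  let S : Set (Set ℝ) := {s | ∃ p : ℚ × ℚ, Set.Ioo (p.1 : ℝ) p.2 = s}
  have hSm : ∀ s ∈ S, MeasurableSet s := by
    rintro _ ⟨p, rfl⟩
    exact measurableSet_Ioo
  have hS : IsPiSystem S := by
    rintro _ ⟨p, rfl⟩ _ ⟨q, rfl⟩ -
    exact ⟨(max p.1 q.1, min p.2 q.2), by simp [Set.Ioo_inter_Ioo]⟩
  -- The sequence is a typical i.i.d. sample of `ν`: the strong law holds almost surely for all the
  -- countably many rational intervals at once. These form a π-system containing a basis of the
  -- topology, which is enough for weak convergence.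
  let P : Measure (ℕ → ℝ) := Measure.infinitePi fun _ => (ν : Measure ℝ)
  have key : ∀ p : ℚ × ℚ, ∀ᵐ x ∂P, Tendsto (fun n : ℕ =>
      (∑ i ∈ Finset.range n, (Set.Ioo (p.1 : ℝ) p.2).indicator (fun _ => (1 : ℝ)) (x i)) / n)
      atTop (𝓝 ((ν : Measure ℝ).real (Set.Ioo (p.1 : ℝ) p.2))) := by
    intro p
    have hm : Measurable ((Set.Ioo (p.1 : ℝ) p.2).indicator fun _ => (1 : ℝ)) :=
      measurable_const.indicator measurableSet_Ioo
    have hmap : ∀ i : ℕ, P.map (fun x => x i) = ν := fun i =>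
      Measure.infinitePi_map_eval (fun _ => (ν : Measure ℝ)) i
    have h := ProbabilityTheory.strong_law_ae_real (μ := P)
      (fun i x => (Set.Ioo (p.1 : ℝ) p.2).indicator (fun _ => (1 : ℝ)) (x i))
      (by
        refine Integrable.of_bound (C := 1)
          (hm.comp (measurable_pi_apply 0)).aestronglyMeasurable (ae_of_all _ fun x => ?_)
        by_cases hx : x 0 ∈ Set.Ioo (p.1 : ℝ) p.2 <;> simp [Set.indicator, hx])
      (fun i j hij => (ProbabilityTheory.iIndepFun_infinitePi
        (P := fun _ : ℕ => (ν : Measure ℝ)) fun _ => hm).indepFun hij)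
      (fun i => ⟨(hm.comp (measurable_pi_apply i)).aemeasurable,
        (hm.comp (measurable_pi_apply 0)).aemeasurable, by
          have h1 : ∀ k : ℕ, P.map (fun x =>
              (Set.Ioo (p.1 : ℝ) p.2).indicator (fun _ => (1 : ℝ)) (x k)) =
              (ν : Measure ℝ).map ((Set.Ioo (p.1 : ℝ) p.2).indicator fun _ => (1 : ℝ)) := by
            intro k
            rw [← hmap k, Measure.map_map hm (measurable_pi_apply k)]
            rfl
          rw [h1 i, h1 0]⟩)
    have hexp : ∫ x, (Set.Ioo (p.1 : ℝ) p.2).indicator (fun _ => (1 : ℝ)) (x 0) ∂P =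
        (ν : Measure ℝ).real (Set.Ioo (p.1 : ℝ) p.2) := by
      rw [← integral_indicator_one measurableSet_Ioo, ← hmap 0,
        integral_map (measurable_pi_apply 0).aemeasurable]
      · rfl
      · exact (measurable_one.indicator measurableSet_Ioo).aestronglyMeasurable
    rwa [hexp] at h
  obtain ⟨x, hx⟩ := (ae_all_iff.2 key).exists
  refine ⟨x, hS.tendsto_probabilityMeasure_of_tendsto_of_mem hSm ?_ ?_⟩
  · intro u hu y hy
    obtain ⟨v, hv, hyv, hvu⟩ :=
      Real.isTopologicalBasis_Ioo_rat.exists_subset_of_mem_open hy hu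
    obtain ⟨a, b, hab, rfl⟩ : ∃ a b : ℚ, a < b ∧ v = Set.Ioo (a : ℝ) b := by simpa using hv
    exact ⟨_, ⟨(a, b), rfl⟩, isOpen_Ioo.mem_nhds hyv, hvu⟩
  · rintro _ ⟨p, rfl⟩
    rw [← NNReal.tendsto_coe]
    change Tendsto (fun n => (empirical x n : Measure ℝ).real _) _ (𝓝 ((ν : Measure ℝ).real _))
    simp only [empirical_real_apply x _ measurableSet_Ioo]
    exact (hx p).comp (tendsto_add_atTop_nat 1)

/-! ### Components and distances in a network -/

namespace Network

variable {V W : Type}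

@[ext]
theorem ext {N M : Network V} (h : ∀ u v, N.ω u v = M.ω u v) : N = M := by
  cases N
  cases M
  congr
  funext u v
  exact h u v

/-- A network sitting in a larger one without edges to the outside has the same components. -/
theorem component_iso_of_embedding [Countable V] [Countable W] (N : Network V) (M : Network W)
    (j : V → W) (hj : Function.Injective j) (hω : ∀ a b, M.ω (j a) (j b) = N.ω a b)
    (hout : ∀ a, ∀ x, x ∉ Set.range j → M.ω (j a) x = 0) (a : V) :
    RootedNetwork.Iso (N.component a) (M.component (j a)) := by
  have hto : ∀ b, N.D a b ≠ ⊤ → M.D (j a) (j b) ≠ ⊤ := by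
    intro b hb
    rw [D_ne_top_iff] at hb ⊢
    exact hb.lift j fun x y hxy => by
      change M.ω (j x) (j y) ≠ 0
      rwa [hω]
  have hfrom : ∀ y, M.D (j a) y ≠ ⊤ → ∃ b, N.D a b ≠ ⊤ ∧ j b = y := by
    intro y hy
    rw [D_ne_top_iff] at hy
    induction hy with
    | refl => exact ⟨a, N.D_self_ne_top a, rfl⟩
    | @tail y z _ hyz ih =>
      obtain ⟨b, hb, rfl⟩ := ih
      obtain ⟨c, rfl⟩ : z ∈ Set.range j := by
        by_contra hz
        exact hyz (hout b z hz)
      refine ⟨c, ?_, rfl⟩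
      rw [hω] at hyz
      rw [D_ne_top_iff] at hb ⊢
      exact hb.tail hyz
  let f : {u : V | N.D a u ≠ ⊤} → {u : W | M.D (j a) u ≠ ⊤} := fun u => ⟨j u, hto u u.2⟩
  have hf : Function.Bijective f := by
    constructor
    · intro u v huv
      exact Subtype.ext (hj (congrArg Subtype.val huv))
    · rintro ⟨y, hy⟩
      obtain ⟨b, hb, rfl⟩ := hfrom y hy
      exact ⟨⟨b, hb⟩, rfl⟩
  exact ⟨Equiv.ofBijective f hf, rfl, fun u v => hω u.1 v.1⟩

theorem IsIso.D_le {N : Network V} {M : Network W} {σ : V ≃ W} (h : N.IsIso M σ) (u v : V) :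
    M.D (σ u) (σ v) ≤ N.D u v := by
  unfold D
  refine le_iInf fun k => le_iInf fun p => le_iInf fun hp => ?_
  refine iInf_le_of_le k (iInf_le_of_le (fun i => σ (p i)) (iInf_le_of_le ?_ (le_of_eq ?_)))
  · exact ⟨congrArg σ hp.1, congrArg σ hp.2.1, fun i hi => by rw [h]; exact hp.2.2 i hi⟩
  · simp only [pathLength, h _ _]

theorem IsIso.D_eq {N : Network V} {M : Network W} {σ : V ≃ W} (h : N.IsIso M σ) (u v : V) :
    M.D (σ u) (σ v) = N.D u v :=
  le_antisymm (h.D_le u v) (by simpa using h.symm.D_le (σ u) (σ v))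

theorem D_self (N : Network V) (u : V) : N.D u u = 0 := by
  refine le_antisymm ?_ bot_le
  unfold D
  refine iInf_le_of_le 0 (iInf_le_of_le (fun _ => u) (iInf_le_of_le ?_ ?_))
  · exact ⟨rfl, rfl, fun i hi => absurd hi (by omega)⟩
  · simp [pathLength]

theorem D_le_of_edge (N : Network V) {u v : V} (h : N.ω u v ≠ 0) :
    N.D u v ≤ ENNReal.ofReal ‖N.ω u v‖⁻¹ := by
  unfold D
  refine iInf_le_of_le 1 (iInf_le_of_le (fun i => if i = 0 then u else v)
    (iInf_le_of_le ?_ (le_of_eq ?_)))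
  · refine ⟨rfl, rfl, fun i hi => ?_⟩
    have : i = 0 := by omega
    subst this
    simpa using h
  · simp [pathLength, ← inv_pow, Real.sqrt_sq]

theorem le_D_of_norm_le (N : Network V) {c : ℝ} (hc : ∀ x y, x ≠ y → ‖N.ω x y‖ ≤ c) {u v : V}
    (huv : u ≠ v) : ENNReal.ofReal c⁻¹ ≤ N.D u v := by
  unfold D
  refine le_iInf fun k => le_iInf fun p => le_iInf fun hp => ENNReal.ofReal_le_ofReal ?_
  obtain ⟨i, hi, hne⟩ : ∃ i < k, p i ≠ p (i + 1) := by
    by_contra! hcon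
    have hconst : ∀ i ≤ k, p i = u := by
      intro i
      induction i with
      | zero => exact fun _ => hp.1
      | succ i ih => exact fun hi => (hcon i (by omega)).symm.trans (ih (by omega))
    exact huv ((hconst k le_rfl).symm.trans hp.2.1)
  have hpos : 0 < ‖N.ω (p i) (p (i + 1))‖ := norm_pos_iff.2 (hp.2.2 i hi)
  calc c⁻¹ ≤ ‖N.ω (p i) (p (i + 1))‖⁻¹ := inv_anti₀ hpos (hc _ _ hne)
    _ = Real.sqrt ((‖N.ω (p i) (p (i + 1))‖ ^ 2)⁻¹) := by
      rw [← inv_pow, Real.sqrt_sq (inv_nonneg.2 hpos.le)]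
    _ ≤ _ := by
      refine Real.sqrt_le_sqrt ?_
      exact Finset.single_le_sum (f := fun i => (‖N.ω (p i) (p (i + 1))‖ ^ 2)⁻¹)
        (fun i _ => by positivity) (Finset.mem_range.2 hi)

theorem ω_self (N : Network V) (v : V) : ((N.ω v v).re : ℂ) = N.ω v v :=
  Complex.conj_eq_iff_re.1 (N.herm v v).symm

end Network

/-! ### The local topology through `Close` -/

namespace RootedNetwork

theorem iso_component_root (G : RootedNetwork) :
    haveI := G.countable
    Iso G (G.net.component G.root) :=
  ⟨(Equiv.subtypeUnivEquiv fun u => G.connected G.root u).symm, rfl, fun _ _ => rfl⟩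

theorem root_mem_ball (G : RootedNetwork) (t : ℝ) : G.root ∈ G.ball t := by
  simp [ball, Network.D_self]

theorem exists_mem_ball (G : RootedNetwork) (v : G.V) :
    ∃ t₀ : ℝ, 0 < t₀ ∧ ∀ t, t₀ ≤ t → v ∈ G.ball t := by
  refine ⟨(G.net.D G.root v).toReal + 1, by positivity, fun t ht => ?_⟩
  change G.net.D G.root v ≤ ENNReal.ofReal t
  rw [← ENNReal.ofReal_toReal (G.connected G.root v)]
  exact ENNReal.ofReal_le_ofReal (by linarith)

theorem Close.of_iso_right {G G' G'' : RootedNetwork} {t : ℝ} (h : Close G G' t)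
    (hi : Iso G' G'') : Close G G'' t := by
  obtain ⟨σ, h0, h⟩ := h
  obtain ⟨τ, k0, k⟩ := hi
  let τ' : G'.ball t ≃ G''.ball t := τ.subtypeEquiv fun u => by
    change G'.net.D _ _ ≤ _ ↔ G''.net.D _ _ ≤ _
    rw [← k0, k.D_eq]
  refine ⟨σ.trans τ', fun u hu => ?_, fun u v => ?_⟩
  · change τ (σ u) = _
    rw [h0 u hu, k0]
  · change ‖_ - G''.net.ω (τ (σ u)) (τ (σ v))‖ ≤ _
    rw [k]
    exact h u v

/-- `Close` is not monotone in the radius, and a large agreement only supplies some large radius at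
which the networks are close. The criterion therefore has to quantify over all `t ≥ t₀`. -/
theorem isOpen_iff {U : Set RootedNetwork} :
    IsOpen U ↔ ∀ G ∈ U, ∃ t₀ : ℝ, 0 < t₀ ∧ ∀ G' t, t₀ ≤ t → Close G G' t → G' ∈ U := by
  constructor
  · intro hU G hG
    obtain ⟨ε, hε, h⟩ := hU G hG
    obtain ⟨n, hn⟩ := ENNReal.exists_inv_nat_lt hε.ne'
    refine ⟨n + 1, by positivity, fun G' t ht hc => h G' (lt_of_le_of_lt ?_ hn)⟩
    rw [dLoc, one_div]
    refine ENNReal.inv_le_inv.2 ?_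
    have h1 : ENNReal.ofReal t ≤ G.agreement G' :=
      le_iSup₂_of_le t ⟨by linarith [(n.cast_nonneg : (0 : ℝ) ≤ n)], hc⟩ le_rfl
    calc (n : ℝ≥0∞) = ENNReal.ofReal n := by simp
      _ ≤ ENNReal.ofReal t := ENNReal.ofReal_le_ofReal (by linarith)
      _ ≤ _ := h1.trans le_add_self
  · intro h G hG
    obtain ⟨t₀, ht₀, h⟩ := h G hG
    refine ⟨(1 + ENNReal.ofReal t₀)⁻¹, by simp, fun G' hG' => ?_⟩
    rw [dLoc, one_div, ENNReal.inv_lt_inv, ENNReal.add_lt_add_iff_left ENNReal.one_ne_top,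
      agreement, lt_iSup_iff] at hG'
    obtain ⟨t, ht⟩ := hG'
    obtain ⟨⟨ht1, ht2⟩, ht⟩ := lt_iSup_iff.1 ht
    exact h G' t ((ENNReal.ofReal_lt_ofReal_iff ht1).1 ht).le ht2

/-- The weight of the loop at the root is continuous. -/
theorem continuous_rootLoop : Continuous fun G : RootedNetwork => G.net.ω G.root G.root := by
  rw [continuous_def]
  intro U hU
  rw [isOpen_iff]
  intro G hG
  obtain ⟨ε, hε, hball⟩ := Metric.isOpen_iff.1 hU _ hG
  refine ⟨2 / ε, by positivity, fun G' t ht hc => hball ?_⟩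
  obtain ⟨σ, h0, h⟩ := hc
  have h1 := h ⟨G.root, G.root_mem_ball t⟩ ⟨G.root, G.root_mem_ball t⟩
  rw [h0 ⟨G.root, G.root_mem_ball t⟩ rfl] at h1
  have ht0 : 0 < t := lt_of_lt_of_le (by positivity) ht
  rw [Metric.mem_ball, dist_comm, dist_eq_norm]
  refine h1.trans_lt ?_
  rw [div_lt_iff₀ ht0]
  rw [div_le_iff₀ hε] at ht
  linarith

end RootedNetwork

/-- The weight of the loop at the root of a class. -/
noncomputable def GStar.rootLoop : GStar → ℂ :=
  Quotient.lift (fun G : RootedNetwork => G.net.ω G.root G.root) (by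
    rintro G G' ⟨σ, h0, h⟩
    rw [← h, h0])

theorem GStar.continuous_rootLoop : Continuous GStar.rootLoop :=
  RootedNetwork.continuous_rootLoop.quotient_lift _

/-- Splitting `∫ ξ_α` into its loop and edge parts requires only one measurable summand, so this
spares a proof that `φ` is measurable. -/
theorem GStar.measurable_psi (α : ℝ) : Measurable (GStar.psi α) := by
  have h : GStar.psi α = fun g => ‖g.rootLoop‖ₑ ^ α := by
    funext g
    induction g using Quotient.inductionOn with
    | _ G => rfl
  rw [h]
  exact GStar.continuous_rootLoop.measurable.enorm.pow_const α

/-! ### Networks with two vertices -/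

/-- The network with two vertices, loops of weight `s` and an edge of weight `w`. -/
noncomputable def twoPoint (p : ℝ × ℂ) : Network Bool where
  ω u v := if u = v then (p.1 : ℂ) else if u then (starRingEnd ℂ) p.2 else p.2
  herm u v := by cases u <;> cases v <;> simp
  locFin _ := Summable.of_finite

/-- The component of a vertex of `twoPoint p`. -/
noncomputable def twoPointRooted (p : ℝ × ℂ) : RootedNetwork := (twoPoint p).component false

/-- The class of `twoPointRooted p`. -/
noncomputable def twoPointClass (p : ℝ × ℂ) : GStar := GStar.mk (twoPointRooted p)

theorem twoPoint_norm_le (p : ℝ × ℂ) {x y : Bool} (h : x ≠ y) : ‖(twoPoint p).ω x y‖ ≤ ‖p.2‖ := by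
  cases x <;> cases y <;> simp_all [twoPoint]

theorem twoPoint_sub_norm_le {p q : ℝ × ℂ} {c : ℝ} (h1 : ‖p.1 - q.1‖ ≤ c) (h2 : ‖p.2 - q.2‖ ≤ c)
    (x y : Bool) : ‖(twoPoint p).ω x y - (twoPoint q).ω x y‖ ≤ c := by
  have h3 : ‖((p.1 : ℂ)) - q.1‖ ≤ c := by
    rwa [← Complex.ofReal_sub, Complex.norm_real]
  have h4 : ‖(starRingEnd ℂ) p.2 - (starRingEnd ℂ) q.2‖ ≤ c := by
    rwa [← map_sub, RCLike.norm_conj]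
  cases x <;> cases y <;> simpa [twoPoint]

theorem true_mem_component {p : ℝ × ℂ} (h : p.2 ≠ 0) :
    (true : Bool) ∈ {u : Bool | (twoPoint p).D false u ≠ ⊤} := by
  refine ne_top_of_le_ne_top ENNReal.ofReal_ne_top ((twoPoint p).D_le_of_edge ?_)
  simpa [twoPoint] using h

theorem ne_zero_of_true_mem_component {p : ℝ × ℂ}
    (h : (true : Bool) ∈ {u : Bool | (twoPoint p).D false u ≠ ⊤}) : p.2 ≠ 0 := by
  intro h0
  have h1 : ReflTransGen (fun x y => (twoPoint p).ω x y ≠ 0) false true :=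
    (Network.D_ne_top_iff _ _ _).1 h
  have h2 : ∀ y, ReflTransGen (fun x y => (twoPoint p).ω x y ≠ 0) false y → y = false := by
    intro y hy
    induction hy with
    | refl => rfl
    | @tail b c _ hbc ih =>
      subst ih
      cases c
      · rfl
      · simp [twoPoint, h0] at hbc
  exact Bool.noConfusion (h2 true h1)

/-- The second vertex, when present, is at distance `1/|w|` from the root. The form `1 ≤ t * |w|`
remains meaningful at `w = 0`. -/
theorem mem_ball_twoPointRooted (p : ℝ × ℂ) {t : ℝ} (ht : 0 < t) (u : (twoPointRooted p).V) :
    u ∈ (twoPointRooted p).ball t ↔ u.1 = false ∨ 1 ≤ t * ‖p.2‖ := by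
  obtain ⟨x, hx⟩ := u
  cases x with
  | false => exact iff_of_true ((twoPointRooted p).root_mem_ball t) (Or.inl rfl)
  | true =>
    have h0 : 0 < ‖p.2‖ := norm_pos_iff.2 (ne_zero_of_true_mem_component hx)
    have hD : (twoPointRooted p).net.D (twoPointRooted p).root ⟨true, hx⟩ =
        ENNReal.ofReal ‖p.2‖⁻¹ := by
      have hω : (twoPointRooted p).net.ω (twoPointRooted p).root ⟨true, hx⟩ = p.2 := rfl
      refine le_antisymm ?_ ?_
      · rw [← hω]
        refine Network.D_le_of_edge _ ?_
        rw [hω]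
        exact norm_pos_iff.1 h0
      · refine Network.le_D_of_norm_le _ (fun x y hxy => ?_) fun h => ?_
        · exact twoPoint_norm_le p fun h => hxy (Subtype.ext h)
        · exact Bool.noConfusion (congrArg Subtype.val h)
    change (twoPointRooted p).net.D (twoPointRooted p).root ⟨true, hx⟩ ≤ _ ↔ _
    rw [hD, ENNReal.ofReal_le_ofReal_iff ht.le, inv_le_iff_one_le_mul₀ h0]
    simp

theorem exists_mem_ball_twoPointRooted {p q : ℝ × ℂ} {t : ℝ} (ht : 0 < t)
    (hpq : 1 ≤ t * ‖p.2‖ ↔ 1 ≤ t * ‖q.2‖) (u : (twoPointRooted p).ball t) :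
    ∃ v : (twoPointRooted q).ball t, v.1.1 = u.1.1 := by
  by_cases hu : u.1.1 = false
  · exact ⟨⟨_, (twoPointRooted q).root_mem_ball t⟩, hu.symm⟩
  · have h : 1 ≤ t * ‖q.2‖ := hpq.1 (((mem_ball_twoPointRooted p ht _).1 u.2).resolve_left hu)
    have h0 : q.2 ≠ 0 := by
      intro h0
      norm_num [h0] at h
    have hu' : u.1.1 = true := (Bool.not_eq_false _).mp hu
    exact ⟨⟨⟨true, true_mem_component h0⟩, (mem_ball_twoPointRooted q ht _).2 (Or.inr h)⟩,
      hu'.symm⟩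

theorem twoPointRooted_root (p : ℝ × ℂ) : (twoPointRooted p).root.1 = false := rfl

theorem twoPointRooted_ω (p : ℝ × ℂ) (u v : (twoPointRooted p).V) :
    (twoPointRooted p).net.ω u v = (twoPoint p).ω u.1 v.1 := rfl

theorem twoPointRooted_close {p q : ℝ × ℂ} {t : ℝ} (ht : 0 < t)
    (hpq : 1 ≤ t * ‖p.2‖ ↔ 1 ≤ t * ‖q.2‖) (h1 : ‖p.1 - q.1‖ ≤ 1 / t) (h2 : ‖p.2 - q.2‖ ≤ 1 / t) :
    (twoPointRooted p).Close (twoPointRooted q) t := by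
  choose f hf using exists_mem_ball_twoPointRooted ht hpq
  choose g hg using exists_mem_ball_twoPointRooted ht hpq.symm
  have hgf : Function.LeftInverse g f :=
    fun u => Subtype.ext (Subtype.ext ((hg _).trans (hf _)))
  have hfg : Function.RightInverse g f :=
    fun u => Subtype.ext (Subtype.ext ((hf _).trans (hg _)))
  have h0 : ∀ u : (twoPointRooted p).ball t, u.1 = (twoPointRooted p).root →
      (f u).1 = (twoPointRooted q).root :=
    fun u hu => Subtype.ext <| by rw [hf, hu, twoPointRooted_root, twoPointRooted_root]
  refine ⟨⟨f, g, hgf, hfg⟩, h0, fun u v => ?_⟩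
  rw [Equiv.coe_fn_mk, twoPointRooted_ω, twoPointRooted_ω, hf, hf]
  exact twoPoint_sub_norm_le h1 h2 _ _

/-- Continuity persists at `w = 0`, where the component loses a vertex: as `w → 0` the second vertex
recedes to infinity and leaves every fixed ball. -/
theorem continuous_twoPointClass : Continuous twoPointClass := by
  rw [continuous_def]
  intro U hU
  have hU' : IsOpen (GStar.mk ⁻¹' U) := isOpen_coinduced.1 hU
  rw [RootedNetwork.isOpen_iff] at hU'
  rw [isOpen_iff_mem_nhds]
  intro p hp
  obtain ⟨t₀, ht₀, h⟩ := hU' (twoPointRooted p) hp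
  -- The ball of radius `t` changes size exactly when `t * |w| = 1`. Away from that value its size
  -- is locally constant in the weights.
  obtain ⟨t, ht, hne⟩ : ∃ t, t₀ ≤ t ∧ t * ‖p.2‖ ≠ 1 := by
    by_cases h1 : t₀ * ‖p.2‖ = 1
    · refine ⟨t₀ + 1, by linarith, fun h2 => ?_⟩
      have : ‖p.2‖ = 0 := by linarith
      rw [this] at h1
      simp at h1
    · exact ⟨t₀, le_rfl, h1⟩
  have ht0 : 0 < t := ht₀.trans_le ht
  have hc : Continuous fun q : ℝ × ℂ => t * ‖q.2‖ := by fun_prop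
  have e1 : ∀ᶠ q in 𝓝 p, (1 ≤ t * ‖p.2‖ ↔ 1 ≤ t * ‖q.2‖) := by
    rcases hne.lt_or_gt with h1 | h1
    · filter_upwards [hc.continuousAt.eventually_lt_const h1] with q hq
      exact iff_of_false (not_le.2 h1) (not_le.2 hq)
    · filter_upwards [hc.continuousAt.eventually_const_lt h1] with q hq
      exact iff_of_true h1.le hq.le
  have e2 : ∀ᶠ q in 𝓝 p, dist q p < 1 / t := Metric.ball_mem_nhds p (by positivity)
  filter_upwards [e1, e2] with q h1 h2
  refine h _ t ht (twoPointRooted_close ht0 h1 ?_ ?_)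
  · rw [← dist_eq_norm, dist_comm]
    exact (le_max_left _ _).trans h2.le
  · rw [← dist_eq_norm, dist_comm]
    exact (le_max_right _ _).trans h2.le

theorem snd_eq_of_iso {p q : ℝ × ℂ} (h : RootedNetwork.Iso (twoPointRooted p) (twoPointRooted q))
    (hp : p.2 ≠ 0) : q.2 = p.2 := by
  obtain ⟨σ, h0, h⟩ := h
  let v : (twoPointRooted p).V := ⟨true, true_mem_component hp⟩
  have h1 := h (twoPointRooted p).root v
  have hv : (σ v).1 = true := by
    by_contra hne
    have h2 : σ v = σ (twoPointRooted p).root := by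
      rw [h0]
      exact Subtype.ext (by exact (Bool.not_eq_true _).mp hne)
    exact Bool.noConfusion (congrArg Subtype.val (σ.injective h2))
  rw [h0] at h1
  change (twoPoint q).ω false (σ v).1 = (twoPoint p).ω false true at h1
  rw [hv] at h1
  simpa [twoPoint] using h1

theorem injective_twoPointClass : Function.Injective twoPointClass := by
  intro p q hpq
  have h : RootedNetwork.Iso (twoPointRooted p) (twoPointRooted q) := Quotient.exact hpq
  refine Prod.ext ?_ ?_
  · obtain ⟨σ, h0, h⟩ := h
    have h1 := h (twoPointRooted p).root (twoPointRooted p).root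
    rw [h0] at h1
    change ((q.1 : ℝ) : ℂ) = (p.1 : ℝ) at h1
    exact_mod_cast h1.symm
  · by_cases hp : p.2 = 0
    · by_cases hq : q.2 = 0
      · rw [hp, hq]
      · exact snd_eq_of_iso (RootedNetwork.isoSetoid.iseqv.symm h) hq
    · exact (snd_eq_of_iso h hp).symm

/-- Both networks contain the one-vertex network `S` with no edge leaving it. Taking the real part
of the loop loses nothing by hermiticity. -/
theorem component_iso_single {V : Type} [Countable V] (N : Network V) (v : V)
    (h : ∀ u, u ≠ v → N.ω v u = 0) :
    GStar.mk (N.component v) = twoPointClass ((N.ω v v).re, 0) := by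
  let S : Network Unit :=
    { ω := fun _ _ => N.ω v v
      herm := fun _ _ => N.herm v v
      locFin := fun _ => Summable.of_finite }
  have h1 := S.component_iso_of_embedding N (fun _ => v) (fun _ _ _ => rfl) (fun _ _ => rfl)
    (fun _ x hx => h x fun hxv => hx ⟨(), hxv.symm⟩) ()
  have h2 := S.component_iso_of_embedding (twoPoint ((N.ω v v).re, 0)) (fun _ => false)
    (fun _ _ _ => rfl) (fun _ _ => by simpa [twoPoint] using N.ω_self v)
    (fun _ x hx => by
      cases x
      · exact absurd ⟨(), rfl⟩ hx
      · simp [twoPoint]) ()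
  exact Quotient.sound (Setoid.trans (Setoid.symm h1) h2)

/-- The embedding lemma compares components, so the edge between `v` and `u` is allowed to have
weight zero. -/
theorem component_iso_pair {V : Type} [Countable V] (N : Network V) {u v : V} (huv : v ≠ u)
    (hloop : N.ω u u = N.ω v v) (hv : ∀ x, x ≠ v → x ≠ u → N.ω v x = 0)
    (hu : ∀ x, x ≠ v → x ≠ u → N.ω u x = 0) :
    GStar.mk (N.component v) = twoPointClass ((N.ω v v).re, N.ω v u) := by
  have hr : ∀ x, x ∉ Set.range (fun b : Bool => if b then u else v) → x ≠ v ∧ x ≠ u :=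
    fun x hx => ⟨fun h => hx ⟨false, by simp [h]⟩, fun h => hx ⟨true, by simp [h]⟩⟩
  have h := (twoPoint ((N.ω v v).re, N.ω v u)).component_iso_of_embedding N
    (fun b => if b then u else v) (fun x y h => by
      cases x <;> cases y <;> simp_all [Ne.symm huv])
    (fun x y => by
      have h1 := N.ω_self v
      have h2 := N.herm u v
      cases x <;> cases y <;> simp_all [twoPoint])
    (fun a x hx => by
      obtain ⟨h1, h2⟩ := hr x hx
      cases a
      · simpa using hv x h1 h2
      · simpa using hu x h1 h2) false
  exact Quotient.sound (Setoid.symm h)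

/-- A network approximated by two-point networks at arbitrarily large radii has at most two
vertices, because its balls are in bijection with subsets of a two-point set. The parameters of the
approximations converge, and closedness of `C` puts the limit in `C`. -/
theorem isClosedMap_twoPointClass : IsClosedMap twoPointClass := by
  intro C hC
  rw [← isOpen_compl_iff]
  refine isOpen_coinduced.2 ?_
  change IsOpen {G : RootedNetwork | GStar.mk G ∉ twoPointClass '' C}
  rw [RootedNetwork.isOpen_iff]
  intro G hG
  by_contra! hcon
  have hclose : ∀ t₀ : ℝ, 0 < t₀ → ∃ q ∈ C, ∃ t, t₀ ≤ t ∧ G.Close (twoPointRooted q) t := by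
    intro t₀ ht₀
    obtain ⟨G', t, ht, hc, hG'⟩ := hcon t₀ ht₀
    obtain ⟨q, hq, hqG⟩ : GStar.mk G' ∈ twoPointClass '' C := by simpa using hG'
    exact ⟨q, hq, t, ht, hc.of_iso_right (Setoid.symm (Quotient.exact hqG))⟩
  have hself : GStar.mk G = GStar.mk (@Network.component _ G.countable G.net G.root) :=
    Quotient.sound G.iso_component_root
  have := G.countable
  -- Take a radius whose ball contains both vertices. The bijection fixes the root, so both must go
  -- to the only other vertex.
  have hsub : ∀ u v : G.V, u ≠ G.root → v ≠ G.root → u = v := by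
    intro u v hu hv
    obtain ⟨t₁, h₁, hu'⟩ := G.exists_mem_ball u
    obtain ⟨t₂, h₂, hv'⟩ := G.exists_mem_ball v
    obtain ⟨q, -, t, ht, σ, h0, -⟩ := hclose (max t₁ t₂) (lt_max_of_lt_left h₁)
    have hr := h0 ⟨G.root, G.root_mem_ball t⟩ rfl
    have htrue : ∀ x : G.ball t, x.1 ≠ G.root → (σ x).1.1 = true := by
      intro x hx
      by_contra hne
      have h2 : σ x = σ ⟨G.root, G.root_mem_ball t⟩ := by
        refine Subtype.ext (Eq.trans (Subtype.ext ?_) hr.symm)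
        exact (Bool.not_eq_true _).mp hne
      exact hx (congrArg Subtype.val (σ.injective h2))
    have h3 : σ ⟨u, hu' t ((le_max_left _ _).trans ht)⟩ =
        σ ⟨v, hv' t ((le_max_right _ _).trans ht)⟩ :=
      Subtype.ext (Subtype.ext ((htrue _ hu).trans (htrue _ hv).symm))
    exact congrArg Subtype.val (σ.injective h3)
  have hloop : ∀ (q : ℝ × ℂ) (t : ℝ), ‖G.net.ω G.root G.root - (q.1 : ℂ)‖ ≤ 1 / t →
      ‖(G.net.ω G.root G.root).re - q.1‖ ≤ 1 / t := by
    intro q t h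
    rwa [← Complex.norm_real, Complex.ofReal_sub, G.net.ω_self]
  by_cases hone : ∀ u, u = G.root
  · refine hG ⟨((G.net.ω G.root G.root).re, 0), ?_, ?_⟩
    · refine hC.closure_subset (Metric.mem_closure_iff.2 fun ε hε => ?_)
      obtain ⟨q, hq, t, ht, σ, h0, h⟩ := hclose (2 / ε) (by positivity)
      have ht0 : 0 < t := lt_of_lt_of_le (by positivity) ht
      have hlt : 1 / t < ε := by
        rw [div_le_iff₀ hε] at ht
        rw [div_lt_iff₀ ht0]
        linarith
      refine ⟨q, hq, ?_⟩
      have hr := h0 ⟨G.root, G.root_mem_ball t⟩ rfl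
      have h1 := h ⟨G.root, G.root_mem_ball t⟩ ⟨G.root, G.root_mem_ball t⟩
      rw [hr] at h1
      -- With a single vertex in `G`, the second vertex of the approximation must lie outside the
      -- ball. This forces `|w| < 1/t`, so the edge weights tend to zero.
      have h2 : ¬ 1 ≤ t * ‖q.2‖ := by
        intro hle
        have hq0 : q.2 ≠ 0 := by
          intro h0
          norm_num [h0] at hle
        let y : (twoPointRooted q).ball t := ⟨⟨true, true_mem_component hq0⟩,
          (mem_ball_twoPointRooted q ht0 _).2 (Or.inr hle)⟩
        have h3 : σ (σ.symm y) = y := σ.apply_symm_apply y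
        have h4 := h0 (σ.symm y) (hone _)
        rw [h3] at h4
        exact Bool.noConfusion (congrArg Subtype.val h4)
      refine lt_of_le_of_lt (max_le ?_ ?_) hlt
      · exact (dist_eq_norm _ _).le.trans (hloop q t h1)
      · rw [dist_zero_left, le_div_iff₀ ht0]
        linarith
    · rw [hself]
      exact (component_iso_single _ _ fun u hu => absurd (hone u) hu).symm
  · push Not at hone
    obtain ⟨v, hv⟩ := hone
    obtain ⟨t₁, h₁, hv'⟩ := G.exists_mem_ball v
    have hall : ∀ x, x ≠ G.root → x ≠ v → False := fun x h1 h2 => h2 (hsub x v h1 hv)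
    have hest : ∀ ε : ℝ, 0 < ε → ∃ q ∈ C, ∃ δ < ε, ‖G.net.ω G.root G.root - (q.1 : ℂ)‖ ≤ δ ∧
        ‖G.net.ω v v - (q.1 : ℂ)‖ ≤ δ ∧ ‖G.net.ω G.root v - q.2‖ ≤ δ ∧
        ‖(G.net.ω G.root G.root).re - q.1‖ ≤ δ := by
      intro ε hε
      obtain ⟨q, hq, t, ht, σ, h0, h⟩ := hclose (max t₁ (2 / ε)) (lt_max_of_lt_left h₁)
      have ht0 : 0 < t := lt_of_lt_of_le (by positivity) ht
      have hlt : 1 / t < ε := by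
        have ht := (le_max_right _ _).trans ht
        rw [div_le_iff₀ hε] at ht
        rw [div_lt_iff₀ ht0]
        linarith
      let o' : G.ball t := ⟨G.root, G.root_mem_ball t⟩
      let v' : G.ball t := ⟨v, hv' t ((le_max_left _ _).trans ht)⟩
      have hr : (σ o').1 = (twoPointRooted q).root := h0 o' rfl
      have hv1 : (σ v').1.1 = true := by
        by_contra hne
        have h2 : σ v' = σ o' := by
          refine Subtype.ext (Eq.trans (Subtype.ext ?_) hr.symm)
          exact (Bool.not_eq_true _).mp hne
        exact hv (congrArg Subtype.val (σ.injective h2))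
      have hr1 : (σ o').1.1 = false := congrArg Subtype.val hr
      have a1 : ‖_ - (twoPoint q).ω (σ o').1.1 (σ o').1.1‖ ≤ 1 / t := h o' o'
      have a2 : ‖_ - (twoPoint q).ω (σ v').1.1 (σ v').1.1‖ ≤ 1 / t := h v' v'
      have a3 : ‖_ - (twoPoint q).ω (σ o').1.1 (σ v').1.1‖ ≤ 1 / t := h o' v'
      rw [hr1] at a1 a3
      rw [hv1] at a2 a3
      exact ⟨q, hq, 1 / t, hlt, a1, a2, a3, hloop q t a1⟩
    refine hG ⟨((G.net.ω G.root G.root).re, G.net.ω G.root v), ?_, ?_⟩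
    · refine hC.closure_subset (Metric.mem_closure_iff.2 fun ε hε => ?_)
      obtain ⟨q, hq, δ, hδ, -, -, h3, h4⟩ := hest ε hε
      refine ⟨q, hq, lt_of_le_of_lt (max_le ?_ ?_) hδ⟩
      · exact (dist_eq_norm _ _).le.trans h4
      · exact (dist_eq_norm _ _).le.trans h3
    · rw [hself]
      refine (component_iso_pair _ hv.symm ?_ (fun x h1 h2 => (hall x h1 h2).elim)
        (fun x h1 h2 => (hall x h1 h2).elim)).symm
      -- The two loops of `G` agree because both are limits of the same number `q.1`.
      refine eq_of_forall_dist_le fun ε hε => ?_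
      obtain ⟨q, -, δ, hδ, h1, h2, -⟩ := hest (ε / 2) (half_pos hε)
      have h3 := dist_triangle_right (G.net.ω v v) (G.net.ω G.root G.root) (q.1 : ℂ)
      rw [dist_eq_norm (G.net.ω v v) (q.1 : ℂ), dist_eq_norm (G.net.ω G.root G.root) (q.1 : ℂ)] at h3
      linarith

theorem measurableEmbedding_twoPointClass : MeasurableEmbedding twoPointClass :=
  (Topology.IsClosedEmbedding.of_continuous_injective_isClosedMap continuous_twoPointClass
    injective_twoPointClass isClosedMap_twoPointClass).measurableEmbedding

/-! ### Truncation of networks with two vertices -/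

theorem Network.ω_eq_zero_of_component {V : Type} (N : Network V) {v a x : V}
    (ha : N.D v a ≠ ⊤) (hx : ¬ N.D v x ≠ ⊤) : N.ω a x = 0 := by
  by_contra h
  rw [Network.D_ne_top_iff] at ha hx
  exact hx (ha.tail h)

theorem Network.deg_component {V : Type} [Countable V] (N : Network V) (v : V)
    (a : (N.component v).V) : (N.component v).net.deg a = N.deg a.1 := by
  unfold Network.deg
  change ∑' u : {u : V | N.D v u ≠ ⊤}, ‖N.ω a.1 u‖ ^ 2 = _
  rw [tsum_subtype {u : V | N.D v u ≠ ⊤} fun u => ‖N.ω a.1 u‖ ^ 2]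
  refine tsum_congr fun u => ?_
  by_cases hu : u ∈ {u : V | N.D v u ≠ ⊤}
  · rw [Set.indicator_of_mem hu]
  · rw [Set.indicator_of_notMem hu, N.ω_eq_zero_of_component a.2 hu]
    simp

/-- Truncating before or after taking the component gives the same result, since degrees are
computed inside the component and no edge leaves it. -/
theorem Network.trunc_component_iso {V : Type} [Countable V] (N : Network V) (v : V)
    (θ : Set.Ioo (0 : ℝ) 1) :
    RootedNetwork.Iso ((N.component v).trunc θ) ((N.trunc θ).component v) := by
  have hdeg := N.deg_component v
  have := (N.component v).countable
  refine Network.component_iso_of_embedding ((N.component v).net.trunc θ) (N.trunc θ)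
    (fun u : {u : V | N.D v u ≠ ⊤} => u.1) Subtype.val_injective ?_ ?_ _
  · intro a b
    have hω : (N.component v).net.ω a b = N.ω a.1 b.1 := rfl
    simp only [Network.trunc, Network.truncDeg, hdeg, hω]
  · intro a x hx
    have hx' : ¬ N.D v x ≠ ⊤ := fun h => hx ⟨⟨x, h⟩, rfl⟩
    simp [Network.trunc, Network.truncDeg, N.ω_eq_zero_of_component a.2 hx']

/-- The sum of the squared moduli of the weights at a vertex of `twoPoint p`. -/
noncomputable def twoPointDeg (p : ℝ × ℂ) : ℝ := ‖p.1‖ ^ 2 + ‖p.2‖ ^ 2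

/-- The weights of the truncation of `twoPoint p`. -/
noncomputable def twoPointTrunc (θ : ℝ) (p : ℝ × ℂ) : ℝ × ℂ :=
  (p.1 * Network.chiTilde θ (twoPointDeg p) *
      Network.chi θ ‖p.1 * Network.chiTilde θ (twoPointDeg p)‖,
    p.2 * (Network.chiTilde θ (twoPointDeg p) : ℂ) *
      (Network.chi θ ‖p.2 * (Network.chiTilde θ (twoPointDeg p) : ℂ)‖ : ℂ))

theorem deg_twoPoint (p : ℝ × ℂ) (x : Bool) : (twoPoint p).deg x = twoPointDeg p := by
  cases x <;> simp [Network.deg, twoPoint, twoPointDeg, add_comm]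

/-- Equal loops give both vertices the same degree and hence the same cutoff factors. This is what
keeps the family stable under truncation. -/
theorem trunc_twoPoint (p : ℝ × ℂ) (θ : Set.Ioo (0 : ℝ) 1) :
    (twoPoint p).trunc θ = twoPoint (twoPointTrunc θ p) := by
  ext x y
  simp only [Network.trunc, Network.truncDeg, deg_twoPoint, max_self]
  cases x <;> cases y <;> simp [twoPoint, twoPointTrunc]

theorem trunc_twoPointClass (p : ℝ × ℂ) (θ : Set.Ioo (0 : ℝ) 1) :
    (twoPointClass p).trunc θ = twoPointClass (twoPointTrunc θ p) := by
  have h := (twoPoint p).trunc_component_iso false θ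
  rw [trunc_twoPoint] at h
  exact Quotient.sound h

theorem Network.measurable_chi (θ : ℝ) : Measurable (Network.chi θ) := by
  unfold Network.chi
  refine Measurable.ite measurableSet_Iio measurable_const
    (Measurable.ite measurableSet_Iio (by fun_prop) measurable_const)

theorem Network.measurable_chiTilde (θ : ℝ) : Measurable (Network.chiTilde θ) := by
  unfold Network.chiTilde
  refine Measurable.ite measurableSet_Iio measurable_const
    (Measurable.ite measurableSet_Iio (by fun_prop) measurable_const)

theorem measurable_twoPointTrunc (θ : ℝ) : Measurable (twoPointTrunc θ) := by
  have h1 : Measurable fun p : ℝ × ℂ => Network.chiTilde θ (twoPointDeg p) := by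
    refine (Network.measurable_chiTilde θ).comp ?_
    unfold twoPointDeg
    fun_prop
  have h2 : Measurable fun p : ℝ × ℂ => (Network.chiTilde θ (twoPointDeg p) : ℂ) :=
    Complex.measurable_ofReal.comp h1
  refine Measurable.prodMk ?_ ?_
  · exact (measurable_fst.mul h1).mul
      ((Network.measurable_chi θ).comp (measurable_fst.mul h1).norm)
  · exact (measurable_snd.mul h2).mul (Complex.measurable_ofReal.comp
      ((Network.measurable_chi θ).comp (measurable_snd.mul h2).norm))

theorem Network.chi_eq_one {θ x : ℝ} (hθ : 0 < θ) (h : 2 * θ ≤ x) : Network.chi θ x = 1 := by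
  unfold Network.chi
  rw [if_neg (by linarith), if_neg (by linarith)]

theorem eventually_twoPointTrunc_eq (p : ℝ × ℂ) :
    ∀ᶠ θ : Set.Ioo (0 : ℝ) 1 in comap (fun θ : Set.Ioo (0 : ℝ) 1 => (θ : ℝ)) (𝓝[>] 0),
      twoPointTrunc θ p = p := by
  have h1 : ∀ᶠ θ : ℝ in 𝓝[>] 0, twoPointDeg p < (θ ^ 2)⁻¹ - 1 := by
    have h : Tendsto (fun θ : ℝ => (θ ^ 2)⁻¹ - 1) (𝓝[>] 0) atTop := by
      have h2 : Tendsto (fun θ : ℝ => (θ⁻¹) ^ 2) (𝓝[>] 0) atTop :=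
        (tendsto_pow_atTop two_ne_zero).comp tendsto_inv_nhdsGT_zero
      simpa [sub_eq_add_neg] using tendsto_atTop_add_const_right _ (-1 : ℝ) h2
    exact h.eventually_gt_atTop _
  -- A zero weight is unaffected by the cutoff, and a nonzero one exceeds `2θ` once `θ` is small.
  have h2 : ∀ r : ℝ, ∀ᶠ θ : ℝ in 𝓝[>] 0, r = 0 ∨ 2 * θ ≤ ‖r‖ := by
    intro r
    by_cases hr : r = 0
    · simp [hr]
    · have h3 : ∀ᶠ θ : ℝ in 𝓝[>] 0, θ < ‖r‖ / 2 :=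
        nhdsWithin_le_nhds (eventually_lt_nhds (by positivity))
      filter_upwards [h3] with θ hθ
      exact Or.inr (by linarith)
  have h3 : ∀ᶠ θ : ℝ in 𝓝[>] 0, 0 < θ ∧ twoPointTrunc θ p = p := by
    filter_upwards [h1, h2 p.1, h2 ‖p.2‖, self_mem_nhdsWithin] with θ e1 e2 e3 e0
    have e4 : Network.chiTilde θ (twoPointDeg p) = 1 := by
      unfold Network.chiTilde
      rw [if_pos e1]
    refine ⟨e0, Prod.ext ?_ ?_⟩
    · simp only [twoPointTrunc, e4, mul_one]
      rcases e2 with e2 | e2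
      · simp [e2]
      · rw [Network.chi_eq_one e0 e2, mul_one]
    · simp only [twoPointTrunc, e4, mul_one, Complex.ofReal_one]
      rw [norm_norm] at e3
      rcases e3 with e3 | e3
      · simp [norm_eq_zero.1 e3]
      · rw [Network.chi_eq_one e0 e3, Complex.ofReal_one, mul_one]
  exact (h3.mono fun θ h => h.2).comap _

/-! ### Spectral measures -/

/-- The action of a bounded operator on `ℓ²` in terms of its matrix. -/
theorem hasSum_apply_of_matrix {V : Type} [DecidableEq V]
    (T : lp (fun _ : V => ℂ) 2 →L[ℂ] lp (fun _ : V => ℂ) 2) (f : lp (fun _ : V => ℂ) 2) (u : V) :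
    HasSum (fun w => f w * T (lp.single 2 w (1 : ℂ)) u) (T f u) := by
  have h1 := (lp.hasSum_single (p := 2) (by simp) f).mapL T
  have h2 := h1.mapL (innerSL ℂ (lp.single 2 u (1 : ℂ) : lp (fun _ : V => ℂ) 2))
  have h3 : ∀ g : lp (fun _ : V => ℂ) 2,
      innerSL ℂ (lp.single 2 u (1 : ℂ) : lp (fun _ : V => ℂ) 2) g = g u := by
    intro g
    rw [innerSL_apply_apply, lp.inner_single_left]
    simp
  simp only [h3] at h2
  refine h2.congr_fun fun w => ?_
  have h4 : (lp.single 2 w (f w) : lp (fun _ : V => ℂ) 2) = f w • lp.single 2 w (1 : ℂ) := by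
    rw [← lp.single_smul, smul_eq_mul, mul_one]
  rw [h4, map_smul]
  rfl

theorem tsum_rpow_le_tsum_rpow {ι : Type*} (f : ι → ℝ≥0∞) {r : ℝ} (h0 : 0 < r) (h1 : r ≤ 1) :
    (∑' i, f i) ^ r ≤ ∑' i, f i ^ r := by
  have ht : Tendsto (fun s : Finset ι => (∑ i ∈ s, f i) ^ r) atTop (𝓝 ((∑' i, f i) ^ r)) :=
    ((ENNReal.continuous_rpow_const).tendsto _).comp ENNReal.summable.hasSum
  refine le_of_tendsto ht (Eventually.of_forall fun s => ?_)
  refine le_trans ?_ (ENNReal.sum_le_tsum s)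
  classical
  induction s using Finset.induction_on with
  | empty => simp [h0]
  | insert a s ha ih =>
    rw [Finset.sum_insert ha, Finset.sum_insert ha]
    exact (ENNReal.rpow_add_le_add_rpow _ _ h0.le h1).trans (add_le_add le_rfl ih)

/-- The `α`-moment of a spectral measure is at most the sum of the `α`-th powers of the weights
at the vertex, for `α ≤ 2`. -/
theorem Network.IsSpectralMeasure.lintegral_rpow_le {V : Type} {N : Network V} {v : V}
    {μ : Measure ℝ} (h : N.IsSpectralMeasure v μ) {α : ℝ} (hα0 : 0 < α) (hα2 : α ≤ 2) :
    ∫⁻ x, ‖x‖ₑ ^ α ∂μ ≤ ∑' u, ‖N.ω v u‖ₑ ^ α := by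
  classical
  obtain ⟨hμ, T, hT, hk⟩ := h
  obtain ⟨hint, hmom⟩ := hk 2
  have hsum := hasSum_apply_of_matrix T (T (lp.single 2 v (1 : ℂ))) v
  have hsq : ∀ w, N.ω w v * N.ω v w = ((‖N.ω v w‖ ^ 2 : ℝ) : ℂ) := by
    intro w
    rw [N.herm w v, mul_comm, Complex.mul_conj, Complex.normSq_eq_norm_sq]
  -- The second moment is the diagonal entry of `T²` at `v`, and hermiticity turns its terms into
  -- squared moduli.
  have h1 : HasSum (fun w => ((‖N.ω v w‖ ^ 2 : ℝ) : ℂ)) ((∫ x, x ^ 2 ∂μ : ℝ) : ℂ) := by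
    have e1 : T (T (lp.single 2 v (1 : ℂ))) v = ((∫ x, x ^ 2 ∂μ : ℝ) : ℂ) := by
      rw [hmom, lp.inner_single_left, pow_two]
      simp
    rw [← e1]
    refine hsum.congr_fun fun w => ?_
    rw [← hsq]
    congr 1 <;> symm <;> convert hT _ _
  have h2 : ∫⁻ x, ‖x‖ₑ ^ (2 : ℝ) ∂μ = ∑' w, ‖N.ω v w‖ₑ ^ (2 : ℝ) := by
    have h3 := Complex.hasSum_ofReal.1 h1
    have e1 : ∀ x : ℝ, ‖x‖ₑ ^ (2 : ℝ) = ENNReal.ofReal (x ^ 2) := by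
      intro x
      rw [ENNReal.rpow_two, ← sq_abs, ENNReal.ofReal_pow (abs_nonneg _), Real.enorm_eq_ofReal_abs]
    have e2 : ∀ z : ℂ, ‖z‖ₑ ^ (2 : ℝ) = ENNReal.ofReal (‖z‖ ^ 2) := by
      intro z
      rw [ENNReal.rpow_two, ENNReal.ofReal_pow (norm_nonneg _), ofReal_norm]
    simp only [e1, e2]
    rw [← ofReal_integral_eq_lintegral_ofReal hint (ae_of_all _ fun x => sq_nonneg x), ← h3.tsum_eq,
      ENNReal.ofReal_tsum_of_nonneg (fun _ => by positivity) h3.summable]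
  -- `Lᵖ` norms increase with the exponent because `μ` is a probability measure.
  have h4 : (∫⁻ x, ‖x‖ₑ ^ α ∂μ) ^ (1 / α) ≤ (∫⁻ x, ‖x‖ₑ ^ (2 : ℝ) ∂μ) ^ (1 / (2 : ℝ)) :=
    eLpNorm'_le_eLpNorm'_of_exponent_le (f := fun x : ℝ => x) hα0 hα2 μ aestronglyMeasurable_id
  calc ∫⁻ x, ‖x‖ₑ ^ α ∂μ = ((∫⁻ x, ‖x‖ₑ ^ α ∂μ) ^ (1 / α)) ^ α := by
        rw [← ENNReal.rpow_mul, one_div_mul_cancel hα0.ne', ENNReal.rpow_one]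
    _ ≤ ((∫⁻ x, ‖x‖ₑ ^ (2 : ℝ) ∂μ) ^ (1 / (2 : ℝ))) ^ α := ENNReal.rpow_le_rpow h4 hα0.le
    _ = (∑' w, ‖N.ω v w‖ₑ ^ (2 : ℝ)) ^ (α / 2) := by
        rw [← ENNReal.rpow_mul, h2]
        congr 1
        ring
    _ ≤ ∑' w, (‖N.ω v w‖ₑ ^ (2 : ℝ)) ^ (α / 2) :=
        tsum_rpow_le_tsum_rpow _ (by positivity) (by linarith)
    _ = ∑' u, ‖N.ω v u‖ₑ ^ α := by
        refine tsum_congr fun u => ?_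
        rw [← ENNReal.rpow_mul]
        congr 1
        ring

/-! ### The spectral measure of a network with two vertices -/

/-- The measure `½ (δ_{s+|w|} + δ_{s-|w|})`. -/
noncomputable def twoPointMeasure (p : ℝ × ℂ) : Measure ℝ :=
  (2 : ℝ≥0∞)⁻¹ • (Measure.dirac (p.1 + ‖p.2‖) + Measure.dirac (p.1 - ‖p.2‖))

instance (p : ℝ × ℂ) : IsProbabilityMeasure (twoPointMeasure p) := ⟨by
  simp only [twoPointMeasure, Measure.smul_apply, Measure.add_apply, measure_univ, smul_eq_mul,
    one_add_one_eq_two]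
  exact ENNReal.inv_mul_cancel (by simp) (by simp)⟩

theorem integrable_twoPointMeasure (p : ℝ × ℂ) {f : ℝ → ℝ} (hf : StronglyMeasurable f) :
    Integrable f (twoPointMeasure p) := by
  have h : ∀ x, Integrable f (Measure.dirac x) := fun x =>
    integrable_dirac' hf enorm_lt_top
  exact ((h _).add_measure (h _)).smul_measure (by simp)

theorem integral_twoPointMeasure (p : ℝ × ℂ) {f : ℝ → ℝ} (hf : StronglyMeasurable f) :
    ∫ x, f x ∂(twoPointMeasure p) = (f (p.1 + ‖p.2‖) + f (p.1 - ‖p.2‖)) / 2 := by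
  have h : ∀ x, Integrable f (Measure.dirac x) := fun x =>
    integrable_dirac' hf enorm_lt_top
  rw [twoPointMeasure, integral_smul_measure, integral_add_measure (h _) (h _),
    integral_dirac' _ _ hf, integral_dirac' _ _ hf]
  simp [div_eq_inv_mul]

/-- A measure with the same moments up to order four as `twoPointMeasure p` is equal to it. -/
theorem eq_twoPointMeasure (p : ℝ × ℂ) (μ : Measure ℝ) [IsProbabilityMeasure μ]
    (h : ∀ k : ℕ, Integrable (fun x : ℝ => x ^ k) μ ∧
      ∫ x, x ^ k ∂μ = ((p.1 + ‖p.2‖) ^ k + (p.1 - ‖p.2‖) ^ k) / 2) :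
    μ = twoPointMeasure p := by
  set s := p.1
  set r := ‖p.2‖
  have h1 : Integrable (fun x : ℝ => x) μ := by simpa using (h 1).1
  have e1 : ∫ x, x ∂μ = s := by
    have := (h 1).2
    simp only [pow_one] at this
    rw [this]
    ring
  have e2 : ∀ c : ℝ, ∫ x, c * x ∂μ = c * s := fun c => by rw [integral_const_mul, e1]
  have h2 := (h 2).1
  have h3 := (h 3).1
  have h4 := (h 4).1
  -- This nonnegative polynomial vanishes exactly at `s ± r`. Its integral involves moments up to
  -- order four, so it is zero as for `twoPointMeasure p`, and `μ` is carried by these two points.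
  have hzero : ∫ x, ((x - s) ^ 2 - r ^ 2) ^ 2 ∂μ = 0 := by
    have e : ∀ x : ℝ, ((x - s) ^ 2 - r ^ 2) ^ 2 = x ^ 4 + (-4 * s) * x ^ 3 +
        (6 * s ^ 2 - 2 * r ^ 2) * x ^ 2 + (-4 * s ^ 3 + 4 * s * r ^ 2) * x +
        (s ^ 2 - r ^ 2) ^ 2 := fun x => by ring
    simp only [e]
    rw [integral_add (((h4.fun_add (h3.const_mul _)).fun_add (h2.const_mul _)).fun_add (h1.const_mul _))
        (integrable_const _),
      integral_add ((h4.fun_add (h3.const_mul _)).fun_add (h2.const_mul _)) (h1.const_mul _),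
      integral_add (h4.fun_add (h3.const_mul _)) (h2.const_mul _),
      integral_add h4 (h3.const_mul _)]
    simp only [e2, integral_const_mul, integral_const, probReal_univ, (h 4).2, (h 3).2, (h 2).2,
      one_smul]
    ring
  have hint : Integrable (fun x : ℝ => ((x - s) ^ 2 - r ^ 2) ^ 2) μ := by
    have e : (fun x : ℝ => ((x - s) ^ 2 - r ^ 2) ^ 2) = fun x => x ^ 4 + (-4 * s) * x ^ 3 +
        (6 * s ^ 2 - 2 * r ^ 2) * x ^ 2 + (-4 * s ^ 3 + 4 * s * r ^ 2) * x +
        (s ^ 2 - r ^ 2) ^ 2 := by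
      funext x
      ring
    rw [e]
    exact (((h4.add (h3.const_mul _)).add (h2.const_mul _)).add (h1.const_mul _)).add
      (integrable_const _)
  have hae : ∀ᵐ x ∂μ, x = s + r ∨ x = s - r := by
    have := (integral_eq_zero_iff_of_nonneg (fun x => by positivity) hint).1 hzero
    filter_upwards [this] with x hx
    have hx' : (x - s) ^ 2 = r ^ 2 := by
      have : (x - s) ^ 2 - r ^ 2 = 0 := by simpa using hx
      linarith
    rcases sq_eq_sq_iff_eq_or_eq_neg.1 hx' with hx | hx
    · left
      linarith
    · right
      linarith
  refine ext_of_forall_integral_eq_of_IsFiniteMeasure fun f => ?_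
  rw [integral_twoPointMeasure p f.continuous.measurable.stronglyMeasurable]
  change _ = (f (s + r) + f (s - r)) / 2
  by_cases hr0 : r = 0
  · have : ∀ᵐ x ∂μ, f x = f s := by
      filter_upwards [hae] with x hx
      rcases hx with hx | hx <;> simp [hx, hr0]
    rw [integral_congr_ae this]
    simp [hr0]
  -- On two points `f` coincides with its affine interpolation, whose integral depends only on the
  -- mean `s`. The slope requires `r ≠ 0`.
  · have : ∀ᵐ x ∂μ, f x = (f (s + r) - f (s - r)) / (2 * r) * x +
        (f (s - r) * (s + r) - f (s + r) * (s - r)) / (2 * r) := by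
      filter_upwards [hae] with x hx
      rcases hx with hx | hx <;> subst hx <;> field_simp <;> ring
    rw [integral_congr_ae this, integral_add (h1.const_mul _) (integrable_const _),
      integral_const_mul, e1]
    simp only [integral_const, probReal_univ, one_smul]
    field_simp
    ring

/-- Cayley–Hamilton for the matrix with diagonal `s` and off-diagonal entries `w`, `conj w`, read on
one column: `A² = 2sA + (|w|² - s²)`. -/
theorem twoPoint_sum (p : ℝ × ℂ) (x : Bool) :
    ∑ b, (twoPoint p).ω b false * (twoPoint p).ω x b =
      2 * p.1 * (twoPoint p).ω x false +
        ((‖p.2‖ : ℂ) ^ 2 - (p.1 : ℂ) ^ 2) * (if x = false then 1 else 0) := by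
  have h := Complex.mul_conj p.2
  rw [Complex.normSq_eq_norm_sq, Complex.ofReal_pow] at h
  cases x
  · simp [twoPoint, ← h]
    ring
  · simp [twoPoint]
    ring

theorem twoPointRooted_sum (p : ℝ × ℂ) (u : (twoPointRooted p).V) :
    ∑' b, (twoPointRooted p).net.ω b (twoPointRooted p).root * (twoPointRooted p).net.ω u b =
      2 * p.1 * (twoPointRooted p).net.ω u (twoPointRooted p).root +
        ((‖p.2‖ : ℂ) ^ 2 - (p.1 : ℂ) ^ 2) * (if u.1 = false then 1 else 0) := by
  have h := twoPoint_sum p u.1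
  simp only [twoPointRooted_ω, twoPointRooted_root]
  rw [← h]
  refine (tsum_subtype {u : Bool | (twoPoint p).D false u ≠ ⊤}
    fun b => (twoPoint p).ω b false * (twoPoint p).ω u.1 b).trans ?_
  rw [tsum_fintype]
  refine Finset.sum_congr rfl fun b _ => ?_
  by_cases hb : b ∈ {u : Bool | (twoPoint p).D false u ≠ ⊤}
  · rw [Set.indicator_of_mem hb]
  · rw [Set.indicator_of_notMem hb, (twoPoint p).ω_eq_zero_of_component u.2 hb, mul_zero]

/-- On the span of `e` and `T e - s e` the operator satisfies a quadratic equation with roots `s ±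
r`, and `T e - s e` is orthogonal to `e`. -/
theorem inner_pow_of_sq_eq {H : Type*} [NormedAddCommGroup H] [InnerProductSpace ℂ H]
    (T : H →L[ℂ] H) (e : H) (s r : ℝ) (he : inner ℂ e e = 1) (h1 : inner ℂ e (T e) = s)
    (h2 : T (T e) = (2 * s : ℂ) • T e + ((r : ℂ) ^ 2 - (s : ℂ) ^ 2) • e) (k : ℕ) :
    inner ℂ e ((T ^ k) e) = ((((s + r) ^ k + (s - r) ^ k) / 2 : ℝ) : ℂ) := by
  -- For `r ≠ 0` one has `c = ((s + r)^k - (s - r)^k) / (2r)`. Recording `r * c` instead of dividing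
  -- covers `r = 0` and gives the recurrence for the half-sum.
  obtain ⟨c, hc, -⟩ : ∃ c : ℂ, (T ^ k) e =
      ((((s + r) ^ k + (s - r) ^ k) / 2 : ℝ) : ℂ) • e + c • (T e - (s : ℂ) • e) ∧
      r * c = ((((s + r) ^ k - (s - r) ^ k) / 2 : ℝ) : ℂ) := by
    induction k with
    | zero => exact ⟨0, by simp, by simp⟩
    | succ k ih =>
      obtain ⟨c, hc, hrc⟩ := ih
      refine ⟨((((s + r) ^ k + (s - r) ^ k) / 2 : ℝ) : ℂ) + s * c, ?_, ?_⟩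
      · have e1 : ((((s + r) ^ (k + 1) + (s - r) ^ (k + 1)) / 2 : ℝ) : ℂ) =
            s * ((((s + r) ^ k + (s - r) ^ k) / 2 : ℝ) : ℂ) + r * (r * c) := by
          rw [hrc]
          push_cast
          ring
        rw [pow_succ', mul_apply_eq_comp, hc, e1]
        simp only [map_add, map_smul, map_sub, h2]
        module
      · rw [mul_add, mul_left_comm, hrc]
        push_cast
        ring
  rw [hc, inner_add_right, inner_smul_right, inner_smul_right, inner_sub_right, inner_smul_right,
    he, h1]
  simp

-- Stated for an arbitrary representative and operator, so that it serves both uniqueness and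
-- existence of the spectral measure of the class.
open Classical in
theorem moments_of_mk_eq_twoPointClass (p : ℝ × ℂ) (G : RootedNetwork)
    (hG : GStar.mk G = twoPointClass p)
    (T : lp (fun _ : G.V => ℂ) 2 →L[ℂ] lp (fun _ : G.V => ℂ) 2)
    (hT : ∀ u w, T (lp.single 2 w (1 : ℂ)) u = G.net.ω u w) (k : ℕ) :
    inner ℂ (lp.single 2 G.root (1 : ℂ) : lp (fun _ : G.V => ℂ) 2)
      ((T ^ k) (lp.single 2 G.root (1 : ℂ))) =
      ((((p.1 + ‖p.2‖) ^ k + (p.1 - ‖p.2‖) ^ k) / 2 : ℝ) : ℂ) := by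
  obtain ⟨σ, h0, hσ⟩ : RootedNetwork.Iso (twoPointRooted p) G :=
    RootedNetwork.isoSetoid.iseqv.symm (Quotient.exact hG)
  refine inner_pow_of_sq_eq T _ p.1 ‖p.2‖ ?_ ?_ ?_ k
  · rw [lp.inner_single_left]
    simp
  · rw [lp.inner_single_left, hT, ← h0, hσ, twoPointRooted_ω, twoPointRooted_root]
    simp [twoPoint]
  · refine lp.ext (funext fun u => ?_)
    obtain ⟨x, rfl⟩ := σ.surjective u
    have hs : HasSum (fun w => G.net.ω w G.root * G.net.ω (σ x) w)
        (T (T (lp.single 2 G.root (1 : ℂ))) (σ x)) :=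
      (hasSum_apply_of_matrix T (T (lp.single 2 G.root (1 : ℂ))) (σ x)).congr_fun fun w => by
        rw [hT, hT]
    have hsum : T (T (lp.single 2 G.root (1 : ℂ))) (σ x) =
        ∑' b, (twoPointRooted p).net.ω b (twoPointRooted p).root *
          (twoPointRooted p).net.ω x b := by
      rw [← hs.tsum_eq, ← σ.tsum_eq, ← h0]
      exact tsum_congr fun b => by rw [hσ, hσ]
    rw [hsum, twoPointRooted_sum, ← h0]
    have e1 : (lp.single 2 (σ (twoPointRooted p).root) (1 : ℂ) : lp (fun _ : G.V => ℂ) 2) (σ x) =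
        if x.1 = false then 1 else 0 := by
      by_cases hx : x.1 = false
      · have : x = (twoPointRooted p).root := Subtype.ext hx
        rw [if_pos hx, this, lp.single_apply_self]
      · rw [if_neg hx, lp.single_apply_ne]
        intro h
        exact hx (congrArg Subtype.val (σ.injective h))
    rw [lp.coeFn_add, Pi.add_apply, lp.coeFn_smul, Pi.smul_apply, lp.coeFn_smul, Pi.smul_apply,
      hT, hσ, e1]
    rfl

theorem GStar.IsSpectralMeasure.eq_twoPointMeasure {p : ℝ × ℂ} {μ : Measure ℝ}
    (h : (twoPointClass p).IsSpectralMeasure μ) : μ = twoPointMeasure p := by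
  obtain ⟨G, hG, hμ, T, hT, hk⟩ := h
  refine WignerLDP.eq_twoPointMeasure p μ fun k => ⟨(hk k).1, ?_⟩
  have h1 := (hk k).2
  rw [moments_of_mk_eq_twoPointClass p G hG T hT] at h1
  exact_mod_cast h1

open Classical in
theorem isSpectralMeasure_twoPointMeasure (p : ℝ × ℂ) :
    (twoPointClass p).IsSpectralMeasure (twoPointMeasure p) := by
  let G := twoPointRooted p
  have : Finite G.V := inferInstanceAs (Finite {u : Bool | (twoPoint p).D false u ≠ ⊤})
  have := Fintype.ofFinite G.V
  let T : lp (fun _ : G.V => ℂ) 2 →L[ℂ] lp (fun _ : G.V => ℂ) 2 :=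
    ∑ x : G.V, ∑ y : G.V, G.net.ω x y •
      (innerSL ℂ (lp.single 2 y (1 : ℂ) : lp (fun _ : G.V => ℂ) 2)).smulRight
        (lp.single 2 x (1 : ℂ) : lp (fun _ : G.V => ℂ) 2)
  have hT : ∀ u w, T (lp.single 2 w (1 : ℂ)) u = G.net.ω u w := by
    intro u w
    have e1 : T (lp.single 2 w (1 : ℂ)) = ∑ x : G.V, G.net.ω x w •
        (lp.single 2 x (1 : ℂ) : lp (fun _ : G.V => ℂ) 2) := by
      simp only [T, sum_apply, smul_apply,
        ContinuousLinearMap.smulRight_apply, innerSL_apply_apply, lp.inner_single_left]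
      refine Finset.sum_congr rfl fun x _ => ?_
      rw [Finset.sum_eq_single w]
      · simp
      · intro y _ hy
        simp [Pi.single_eq_of_ne hy]
      · simp
    rw [e1, lp.coeFn_sum, Finset.sum_apply, Finset.sum_eq_single u]
    · simp
    · intro y _ hy
      simp [Pi.single_eq_of_ne hy.symm]
    · simp
  refine ⟨G, rfl, inferInstance, T, hT, fun k => ⟨?_, ?_⟩⟩
  · exact integrable_twoPointMeasure p (by fun_prop : Measurable fun x : ℝ => x ^ k).stronglyMeasurable
  · rw [moments_of_mk_eq_twoPointClass p G rfl T hT, integral_twoPointMeasure p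
      (by fun_prop : Measurable fun x : ℝ => x ^ k).stronglyMeasurable]

theorem spectralMeasure_twoPointClass (p : ℝ × ℂ) :
    (twoPointClass p).spectralMeasure = twoPointMeasure p := by
  have h : ∃ μ, (twoPointClass p).IsSpectralMeasure μ := ⟨_, isSpectralMeasure_twoPointMeasure p⟩
  rw [GStar.spectralMeasure, dif_pos h]
  exact h.choose_spec.eq_twoPointMeasure

/-! ### The lower bound -/

theorem RootedNetwork.xi_eq (α : ℝ) (G : RootedNetwork) : xi α G = psi α G + 2 * phi α G := by
  have h := Summable.tsum_add_tsum_compl (s := {G.root})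
    (f := fun v => ‖G.net.ω G.root v‖ₑ ^ α) ENNReal.summable ENNReal.summable
  rw [xi, psi, phi, ENNReal.mul_div_cancel (by simp) (by simp), ← h]
  congr 1
  rw [tsum_singleton G.root fun v => ‖G.net.ω G.root v‖ₑ ^ α]

theorem GStar.xi_eq (α : ℝ) (g : GStar) : g.xi α = g.psi α + 2 * g.phi α := by
  induction g using Quotient.inductionOn with
  | _ G => exact RootedNetwork.xi_eq α G

theorem Network.norm_trunc_le {V : Type} (N : Network V) (θ : Set.Ioo (0 : ℝ) 1) (u v : V) :
    ‖(N.trunc θ).ω u v‖ ≤ ‖N.ω u v‖ := by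
  have h1 := chi_mem θ.2.1 ‖N.truncDeg θ u v‖
  have h2 := chiTilde_mem θ (max (N.deg u) (N.deg v))
  have h3 : ‖N.truncDeg θ u v‖ ≤ ‖N.ω u v‖ := by
    rw [truncDeg, norm_mul, Complex.norm_real, Real.norm_of_nonneg h2.1]
    exact mul_le_of_le_one_right (norm_nonneg _) h2.2
  change ‖N.truncDeg θ u v * (chi θ ‖N.truncDeg θ u v‖ : ℂ)‖ ≤ _
  rw [norm_mul, Complex.norm_real, Real.norm_of_nonneg h1.1]
  exact (mul_le_of_le_one_right (norm_nonneg _) h1.2).trans h3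

theorem GStar.xi_trunc_le {α : ℝ} (hα : 0 ≤ α) (θ : Set.Ioo (0 : ℝ) 1) (g : GStar) :
    (g.trunc θ).xi α ≤ g.xi α := by
  induction g using Quotient.inductionOn with
  | _ G =>
    change ∑' v : {u : G.V | (G.net.trunc θ).D G.root u ≠ ⊤},
      ‖(G.net.trunc θ).ω G.root v‖ₑ ^ α ≤ ∑' v : G.V, ‖G.net.ω G.root v‖ₑ ^ α
    refine le_trans (ENNReal.tsum_le_tsum fun v => ?_)
      (ENNReal.tsum_comp_le_tsum_of_injective Subtype.val_injective _)
    exact ENNReal.rpow_le_rpow (enorm_le_iff_norm_le.2 (G.net.norm_trunc_le θ G.root v)) hα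

theorem GStar.lintegral_spectralMeasure_le {α : ℝ} (hα0 : 0 < α) (hα2 : α ≤ 2) (g : GStar) :
    ∫⁻ x, ‖x‖ₑ ^ α ∂g.spectralMeasure ≤ g.xi α := by
  unfold GStar.spectralMeasure
  split_ifs with h
  · obtain ⟨G, hG, hs⟩ := h.choose_spec
    refine (hs.lintegral_rpow_le hα0 hα2).trans (le_of_eq ?_)
    rw [← hG]
    rfl
  · rw [lintegral_dirac]
    simp [hα0]

/-- The inequality for `bind` holds without measurability of the spectral measure in `g`. -/
theorem lintegral_truncSpectral_le {α : ℝ} (hα0 : 0 < α) (hα2 : α ≤ 2)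
    (ρ : ProbabilityMeasure GStar) (θ : Set.Ioo (0 : ℝ) 1) :
    ∫⁻ x, ‖x‖ₑ ^ α ∂(truncSpectral ρ θ) ≤ ∫⁻ g, g.xi α ∂(ρ : Measure GStar) :=
  (Measure.lintegral_bind_le _ _ _).trans <| lintegral_mono fun g =>
    ((g.trunc θ).lintegral_spectralMeasure_le hα0 hα2).trans (g.xi_trunc_le hα0.le θ)

theorem neBot_comap_Ioo :
    (comap (fun θ : Set.Ioo (0 : ℝ) 1 => (θ : ℝ)) (𝓝[>] 0)).NeBot := by
  refine NeBot.comap_of_range_mem inferInstance ?_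
  rw [Subtype.range_coe]
  exact Ioo_mem_nhdsGT one_pos

theorem absMoment_le_of_isSpectralLimit {α : ℝ} (hα0 : 0 < α) (hα2 : α ≤ 2)
    {ρ : ProbabilityMeasure GStar} {ν : ProbabilityMeasure ℝ} (h : IsSpectralLimit ρ ν) :
    absMoment α ν ≤ ∫⁻ g, g.xi α ∂(ρ : Measure GStar) := by
  set M := ∫⁻ g, g.xi α ∂(ρ : Measure GStar) with hM
  by_cases hMtop : M = ⊤
  · rw [hMtop]
    exact le_top
  have := neBot_comap_Ioo
  have hcont : Continuous fun x : ℝ => |x| ^ α :=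
    continuous_abs.rpow_const fun _ => Or.inr hα0.le
  have hnorm : ∀ x : ℝ, ‖x‖ₑ ^ α = ENNReal.ofReal (|x| ^ α) := fun x => by
    rw [Real.enorm_eq_ofReal_abs, ENNReal.ofReal_rpow_of_nonneg (abs_nonneg _) hα0.le]
  -- `|x|^α` is not a bounded test function. It is cut at height `K`, and monotone convergence
  -- removes the cut.
  have hK : ∀ K : ℕ, ∫⁻ x, min (‖x‖ₑ ^ α) K ∂(ν : Measure ℝ) ≤ M := by
    intro K
    have hbound : ∀ x : ℝ, ‖min (|x| ^ α) (K : ℝ)‖ ≤ K := fun x => by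
      rw [Real.norm_of_nonneg (le_min (by positivity) (by positivity))]
      exact min_le_right _ _
    let f : ℝ →ᵇ ℝ := BoundedContinuousFunction.ofNormedAddCommGroup
      (fun x => min (|x| ^ α) (K : ℝ)) (hcont.min continuous_const) K hbound
    have hf0 : ∀ x, 0 ≤ f x := fun x => le_min (by positivity) (by positivity)
    have hfe : ∀ x, ENNReal.ofReal (f x) = min (‖x‖ₑ ^ α) K := fun x => by
      change ENNReal.ofReal (min (|x| ^ α) (K : ℝ)) = _
      rw [ENNReal.ofReal_min, hnorm, ENNReal.ofReal_natCast]
    have hfm : Measurable f := f.continuous.measurable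
    have hle : ∫ x, f x ∂(ν : Measure ℝ) ≤ M.toReal := by
      refine le_of_tendsto (h f) (Eventually.of_forall fun θ => ?_)
      rw [integral_eq_lintegral_of_nonneg_ae (ae_of_all _ hf0) hfm.aestronglyMeasurable]
      refine ENNReal.toReal_mono hMtop ?_
      refine le_trans (lintegral_mono fun x => ?_) (lintegral_truncSpectral_le hα0 hα2 ρ θ)
      rw [hfe]
      exact min_le_left _ _
    simp only [← hfe]
    rw [← ofReal_integral_eq_lintegral_ofReal (f.integrable _) (ae_of_all _ hf0)]
    exact ENNReal.ofReal_le_of_le_toReal hle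
  have hsup : ∀ x : ℝ, ‖x‖ₑ ^ α = ⨆ K : ℕ, min (‖x‖ₑ ^ α) (K : ℝ≥0∞) := fun x => by
    rw [← inf_iSup_eq, ENNReal.iSup_natCast, inf_top_eq]
  rw [absMoment, lintegral_congr hsup, lintegral_iSup]
  · exact iSup_le hK
  · intro K
    exact (measurable_id.enorm.pow_const α).min measurable_const
  · intro i j hij x
    exact min_le_min le_rfl (by exact_mod_cast hij)

theorem isSpectralLimit_spectral {ρ : ProbabilityMeasure GStar}
    (h : (∃ β : ℝ, 0 < β ∧ β < 2 ∧ ∫⁻ g, g.xi β ∂(ρ : Measure GStar) < ⊤) ∧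
      ∃ μ, IsSpectralLimit ρ μ) : IsSpectralLimit ρ (spectral ρ) := by
  have e : spectral ρ = h.2.choose := dif_pos h
  rw [e]
  exact h.2.choose_spec

theorem spectral_of_not {ρ : ProbabilityMeasure GStar}
    (h : ¬((∃ β : ℝ, 0 < β ∧ β < 2 ∧ ∫⁻ g, g.xi β ∂(ρ : Measure GStar) < ⊤) ∧
      ∃ μ, IsSpectralLimit ρ μ)) : spectral ρ = ⟨Measure.dirac 0, inferInstance⟩ :=
  dif_neg h

theorem min_mul_absMoment_le_ratePhi {α : ℝ} (hα0 : 0 < α) (hα2 : α ≤ 2) (a b : ℝ≥0∞)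
    (Sa Sb : Set ℂ) (ν : ProbabilityMeasure ℝ) :
    min (a / 2) b * absMoment α ν ≤ ratePhi α a b Sa Sb ν := by
  refine le_iInf₂ fun ρ hρ => ?_
  obtain ⟨hs, rfl⟩ := hρ
  rw [rateI, if_pos hs]
  by_cases h : (∃ β : ℝ, 0 < β ∧ β < 2 ∧ ∫⁻ g, g.xi β ∂(ρ : Measure GStar) < ⊤) ∧
      ∃ μ, IsSpectralLimit ρ μ
  · have h1 := absMoment_le_of_isSpectralLimit hα0 hα2 (isSpectralLimit_spectral h)
    have h3 : min (a / 2) b * 2 ≤ a :=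
      (mul_le_mul_left (min_le_left _ _) _).trans_eq (ENNReal.div_mul_cancel (by simp) (by simp))
    have h2 : ∫⁻ g, g.xi α ∂(ρ : Measure GStar) =
        ∫⁻ g, g.psi α ∂(ρ : Measure GStar) + 2 * ∫⁻ g, g.phi α ∂(ρ : Measure GStar) := by
      simp only [GStar.xi_eq]
      rw [lintegral_add_left (GStar.measurable_psi α), lintegral_const_mul' _ _ (by simp)]
    calc _ ≤ min (a / 2) b * ∫⁻ g, g.xi α ∂(ρ : Measure GStar) := mul_le_mul_right h1 _
      _ = min (a / 2) b * ∫⁻ g, g.psi α ∂(ρ : Measure GStar) +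
          min (a / 2) b * 2 * ∫⁻ g, g.phi α ∂(ρ : Measure GStar) := by
        rw [h2, mul_add, mul_assoc]
      _ ≤ _ := add_le_add (mul_le_mul_left (min_le_right _ _) _) (mul_le_mul_left h3 _)
  · have : absMoment α ⟨Measure.dirac 0, inferInstance⟩ = 0 := by
      change ∫⁻ x : ℝ, ‖x‖ₑ ^ α ∂(Measure.dirac 0) = 0
      rw [lintegral_dirac]
      simp [hα0]
    rw [spectral_of_not h, this, mul_zero]
    exact bot_le

/-! ### Random networks with two vertices -/

theorem spectral_eq_of_isSpectralLimit {ρ : ProbabilityMeasure GStar} {ν : ProbabilityMeasure ℝ}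
    {β : ℝ} (hβ0 : 0 < β) (hβ2 : β < 2) (hβ : ∫⁻ g, g.xi β ∂(ρ : Measure GStar) < ⊤)
    (h : IsSpectralLimit ρ ν) : spectral ρ = ν := by
  have h1 := isSpectralLimit_spectral ⟨⟨β, hβ0, hβ2, hβ⟩, ν, h⟩
  have := neBot_comap_Ioo
  have h2 : (spectral ρ : Measure ℝ) = (ν : Measure ℝ) :=
    ext_of_forall_integral_eq_of_IsFiniteMeasure fun f => tendsto_nhds_unique (h1 f) (h f)
  exact Subtype.ext h2

theorem measurable_twoPointMeasure : Measurable twoPointMeasure := by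
  refine Measure.measurable_of_measurable_coe _ fun s hs => ?_
  have h : ∀ p : ℝ × ℂ, twoPointMeasure p s =
      2⁻¹ * (s.indicator 1 (p.1 + ‖p.2‖) + s.indicator 1 (p.1 - ‖p.2‖)) := fun p => by
    simp [twoPointMeasure, Measure.dirac_apply' _ hs, mul_add]
  simp only [h]
  have hm : Measurable (s.indicator (1 : ℝ → ℝ≥0∞)) := measurable_one.indicator hs
  exact ((hm.comp (by fun_prop)).add (hm.comp (by fun_prop))).const_mul _

theorem integral_bind_twoPointMeasure {X : Type*} [MeasurableSpace X] (κ : Measure X)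
    [IsProbabilityMeasure κ] {h : X → ℝ × ℂ} (hh : Measurable h) (f : ℝ →ᵇ ℝ) :
    ∫ x, f x ∂(κ.bind fun p => twoPointMeasure (h p)) =
      ∫ p, (f ((h p).1 + ‖(h p).2‖) + f ((h p).1 - ‖(h p).2‖)) / 2 ∂κ := by
  have m1 : Measurable fun p => (h p).1 + ‖(h p).2‖ := by fun_prop
  have m2 : Measurable fun p => (h p).1 - ‖(h p).2‖ := by fun_prop
  have hb : κ.bind (fun p => twoPointMeasure (h p)) =
      (2 : ℝ≥0∞)⁻¹ • (κ.map (fun p => (h p).1 + ‖(h p).2‖) +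
        κ.map fun p => (h p).1 - ‖(h p).2‖) := by
    refine Measure.ext fun s hs => ?_
    have hm : Measurable fun p => twoPointMeasure (h p) := measurable_twoPointMeasure.comp hh
    rw [Measure.bind_apply hs hm.aemeasurable]
    have e : ∀ p, twoPointMeasure (h p) s =
        2⁻¹ * (((fun p => (h p).1 + ‖(h p).2‖) ⁻¹' s).indicator 1 p +
          ((fun p => (h p).1 - ‖(h p).2‖) ⁻¹' s).indicator 1 p) := fun p => by
      simp only [twoPointMeasure, Measure.smul_apply, Measure.add_apply, Measure.dirac_apply' _ hs,
        smul_eq_mul]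
      rfl
    simp only [e]
    rw [lintegral_const_mul' _ _ (by simp), lintegral_add_left
      (measurable_one.indicator (m1 hs)), lintegral_indicator_one (m1 hs),
      lintegral_indicator_one (m2 hs), Measure.smul_apply, Measure.add_apply,
      Measure.map_apply m1 hs, Measure.map_apply m2 hs, smul_eq_mul]
  have := Measure.isProbabilityMeasure_map (μ := κ) m1.aemeasurable
  have := Measure.isProbabilityMeasure_map (μ := κ) m2.aemeasurable
  have i1 : Integrable (fun p => f ((h p).1 + ‖(h p).2‖)) κ :=
    (f.integrable _).comp_measurable m1
  have i2 : Integrable (fun p => f ((h p).1 - ‖(h p).2‖)) κ :=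
    (f.integrable _).comp_measurable m2
  rw [hb, integral_smul_measure, integral_add_measure (f.integrable _) (f.integrable _),
    integral_map m1.aemeasurable f.continuous.aestronglyMeasurable,
    integral_map m2.aemeasurable f.continuous.aestronglyMeasurable, integral_div,
    integral_add i1 i2]
  simp [div_eq_inv_mul]

/-- The law of `twoPointClass` under a law of the weights. -/
noncomputable def twoPointLaw (κ : ProbabilityMeasure (ℝ × ℂ)) : ProbabilityMeasure GStar :=
  κ.map continuous_twoPointClass.measurable.aemeasurable

theorem integral_truncSpectral_twoPointLaw (κ : ProbabilityMeasure (ℝ × ℂ))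
    (θ : Set.Ioo (0 : ℝ) 1) (f : ℝ →ᵇ ℝ) :
    ∫ x, f x ∂(truncSpectral (twoPointLaw κ) θ) =
      ∫ p, (f ((twoPointTrunc θ p).1 + ‖(twoPointTrunc θ p).2‖) +
        f ((twoPointTrunc θ p).1 - ‖(twoPointTrunc θ p).2‖)) / 2 ∂(κ : Measure (ℝ × ℂ)) := by
  have hm := measurable_twoPointTrunc θ
  have hF : (fun g : GStar => (g.trunc θ).spectralMeasure) ∘ twoPointClass =
      fun p => twoPointMeasure (twoPointTrunc θ p) := by
    funext p
    rw [Function.comp_apply, trunc_twoPointClass, spectralMeasure_twoPointClass]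
  have hae : AEMeasurable (fun g : GStar => (g.trunc θ).spectralMeasure)
      ((κ : Measure (ℝ × ℂ)).map twoPointClass) := by
    -- The closed embedding is used here: along it the chosen spectral measures are the explicit
    -- `twoPointMeasure`, measurable in the weights.
    rw [measurableEmbedding_twoPointClass.aemeasurable_map_iff, hF]
    exact (measurable_twoPointMeasure.comp hm).aemeasurable
  have hb : truncSpectral (twoPointLaw κ) θ =
      (κ : Measure (ℝ × ℂ)).bind fun p => twoPointMeasure (twoPointTrunc θ p) := by
    change ((κ : Measure (ℝ × ℂ)).map twoPointClass).bind _ = _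
    rw [Measure.bind, Measure.bind, ← hF, AEMeasurable.map_map_of_aemeasurable hae
      continuous_twoPointClass.measurable.aemeasurable]
  rw [hb, integral_bind_twoPointMeasure _ hm]

/-- For each fixed pair of weights the truncation is eventually trivial, and dominated convergence
applies with bound `‖f‖`. -/
theorem isSpectralLimit_twoPointLaw {κ : ProbabilityMeasure (ℝ × ℂ)} {ν : ProbabilityMeasure ℝ}
    (h : ∀ f : ℝ →ᵇ ℝ, ∫ x, f x ∂(ν : Measure ℝ) =
      ∫ p, (f (p.1 + ‖p.2‖) + f (p.1 - ‖p.2‖)) / 2 ∂(κ : Measure (ℝ × ℂ))) :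
    IsSpectralLimit (twoPointLaw κ) ν := by
  intro f
  rw [h f]
  simp only [integral_truncSpectral_twoPointLaw]
  have hfm := f.continuous.measurable
  refine tendsto_integral_filter_of_dominated_convergence (fun _ => ‖f‖)
    (Eventually.of_forall fun θ => ?_) (Eventually.of_forall fun θ => ae_of_all _ fun p => ?_)
    (integrable_const _) (ae_of_all _ fun p => ?_)
  · have hm := measurable_twoPointTrunc θ
    refine Measurable.aestronglyMeasurable ?_
    exact ((hfm.comp (hm.fst.add hm.snd.norm)).add (hfm.comp (hm.fst.sub hm.snd.norm))).div_const _
  · rw [norm_div, Real.norm_two, div_le_iff₀ two_pos, mul_two]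
    exact (norm_add_le _ _).trans (add_le_add (f.norm_coe_le_norm _) (f.norm_coe_le_norm _))
  · refine tendsto_const_nhds.congr' ?_
    filter_upwards [eventually_twoPointTrunc_eq p] with θ hθ
    rw [hθ]

theorem psi_twoPointClass (α : ℝ) (p : ℝ × ℂ) : (twoPointClass p).psi α = ‖p.1‖ₑ ^ α := by
  change ‖(twoPointRooted p).net.ω _ _‖ₑ ^ α = _
  rw [twoPointRooted_ω, twoPointRooted_root]
  change ‖(p.1 : ℂ)‖ₑ ^ α = _
  rw [← ofReal_norm, Complex.norm_real, ofReal_norm]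

theorem phi_twoPointClass_le (α : ℝ) (p : ℝ × ℂ) : (twoPointClass p).phi α ≤ ‖p.2‖ₑ ^ α / 2 := by
  refine ENNReal.div_le_div_right ?_ 2
  have h : ∀ v : {v : (twoPointRooted p).V // v ≠ (twoPointRooted p).root}, v.1.1 = true := by
    intro v
    refine (Bool.not_eq_false _).mp fun h => v.2 (Subtype.ext ?_)
    rw [h, twoPointRooted_root]
  have h2 : ∀ v : {v : (twoPointRooted p).V // v ≠ (twoPointRooted p).root},
      ‖(twoPointRooted p).net.ω (twoPointRooted p).root v‖ₑ ^ α = ‖p.2‖ₑ ^ α := by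
    intro v
    rw [twoPointRooted_ω, twoPointRooted_root, h v]
    rfl
  have hinj : Function.Injective
      fun _ : {v : (twoPointRooted p).V // v ≠ (twoPointRooted p).root} => () :=
    fun u v _ => Subtype.ext (Subtype.ext ((h u).trans (h v).symm))
  rw [tsum_congr h2]
  refine (ENNReal.tsum_comp_le_tsum_of_injective hinj fun _ => ‖p.2‖ₑ ^ α).trans ?_
  simp

/-- Finiteness of both moments gives `𝔼 ξ_β < ∞` with `β = α`, so `spectral` is the actual limit and
not the default `δ₀`. -/
theorem ratePhi_le_of_twoPointLaw {α : ℝ} (hα0 : 0 < α) (hα2 : α < 2) {a b : ℝ≥0∞}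
    {Sa Sb : Set ℂ} {κ : ProbabilityMeasure (ℝ × ℂ)} {ν : ProbabilityMeasure ℝ}
    (hs : IsAdmissibleSofic Sa Sb (twoPointLaw κ))
    (hν : ∀ f : ℝ →ᵇ ℝ, ∫ x, f x ∂(ν : Measure ℝ) =
      ∫ p, (f (p.1 + ‖p.2‖) + f (p.1 - ‖p.2‖)) / 2 ∂(κ : Measure (ℝ × ℂ)))
    (h1 : ∫⁻ p, ‖p.1‖ₑ ^ α ∂(κ : Measure (ℝ × ℂ)) ≠ ⊤)
    (h2 : ∫⁻ p, ‖p.2‖ₑ ^ α ∂(κ : Measure (ℝ × ℂ)) ≠ ⊤) :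
    ratePhi α a b Sa Sb ν ≤ b * ∫⁻ p, ‖p.1‖ₑ ^ α ∂(κ : Measure (ℝ × ℂ)) +
      a / 2 * ∫⁻ p, ‖p.2‖ₑ ^ α ∂(κ : Measure (ℝ × ℂ)) := by
  have hpsi : ∫⁻ g, g.psi α ∂(twoPointLaw κ : Measure GStar) ≤
      ∫⁻ p, ‖p.1‖ₑ ^ α ∂(κ : Measure (ℝ × ℂ)) := by
    refine (lintegral_map_le _ _).trans (lintegral_mono fun p => ?_)
    rw [psi_twoPointClass]
  have hphi : ∫⁻ g, g.phi α ∂(twoPointLaw κ : Measure GStar) ≤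
      (∫⁻ p, ‖p.2‖ₑ ^ α ∂(κ : Measure (ℝ × ℂ))) / 2 := by
    refine (lintegral_map_le _ _).trans ?_
    rw [ENNReal.div_eq_inv_mul, ← lintegral_const_mul' _ _ (by simp)]
    refine lintegral_mono fun p => ?_
    rw [← ENNReal.div_eq_inv_mul]
    exact phi_twoPointClass_le α p
  have hxi : ∫⁻ g, g.xi α ∂(twoPointLaw κ : Measure GStar) < ⊤ := by
    simp only [GStar.xi_eq]
    rw [lintegral_add_left (GStar.measurable_psi α), lintegral_const_mul' _ _ (by simp)]
    exact ENNReal.add_lt_top.2 ⟨hpsi.trans_lt h1.lt_top, ENNReal.mul_lt_top (by simp)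
      (hphi.trans_lt (ENNReal.div_lt_top h2 (by simp)))⟩
  have hsp := spectral_eq_of_isSpectralLimit hα0 hα2 hxi (isSpectralLimit_twoPointLaw hν)
  refine iInf₂_le_of_le (twoPointLaw κ) ⟨hs, hsp⟩ ?_
  rw [rateI, if_pos hs]
  refine add_le_add (mul_le_mul_right hpsi _) ((mul_le_mul_right hphi _).trans (le_of_eq ?_))
  rw [← ENNReal.mul_comm_div]

theorem isAdmissibleSofic_twoPointLaw {Sa Sb : Set ℂ} {κ : ProbabilityMeasure (ℝ × ℂ)}
    (H : (n : ℕ) → Matrix (Fin (n + 1)) (Fin (n + 1)) ℂ)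
    (hH : ∀ n, H n ∈ admissible Sa Sb (n + 1)) (c : (n : ℕ) → Fin (n + 1) → ℝ × ℂ)
    (hc : ∀ n v, GStar.mk ((Network.ofMatrix (H n) (hH n).1).component v) = twoPointClass (c n v))
    (hlim : ∀ g : (ℝ × ℂ) →ᵇ ℝ, Tendsto (fun n : ℕ => (∑ v, g (c n v)) / ((n + 1 : ℕ) : ℝ)) atTop
      (𝓝 (∫ p, g p ∂(κ : Measure (ℝ × ℂ))))) :
    IsAdmissibleSofic Sa Sb (twoPointLaw κ) := by
  refine ⟨H, hH, ?_⟩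
  rw [ProbabilityMeasure.tendsto_iff_forall_integral_tendsto]
  intro f
  have hf : StronglyMeasurable f := f.continuous.measurable.stronglyMeasurable
  have h1 : ∫ g, f g ∂(twoPointLaw κ : Measure GStar) =
      ∫ p, f.compContinuous ⟨_, continuous_twoPointClass⟩ p ∂(κ : Measure (ℝ × ℂ)) :=
    integral_map continuous_twoPointClass.measurable.aemeasurable hf.aestronglyMeasurable
  rw [h1]
  refine (hlim (f.compContinuous ⟨_, continuous_twoPointClass⟩)).congr fun n => ?_
  change _ = ∫ g, f g ∂((Fintype.card (Fin (n + 1)) : ℝ≥0∞)⁻¹ • ∑ v : Fin (n + 1),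
    Measure.dirac (GStar.mk ((Network.ofMatrix (H n) (hH n).1).component v)))
  rw [integral_smul_measure, integral_finsetSum_measure fun i _ => f.integrable _]
  simp only [integral_dirac' _ _ hf, hc]
  rw [ENNReal.toReal_inv, ENNReal.toReal_natCast, smul_eq_mul, div_eq_inv_mul, Fintype.card_fin]
  rfl

/-! ### Diagonal matrices -/

theorem diagonal_mem_admissible {Sa Sb : Set ℂ} (hSb : {-1, 1} ⊆ Sb) {n : ℕ} (x : Fin n → ℝ) :
    Matrix.diagonal (fun i => (x i : ℂ)) ∈ admissible Sa Sb n := by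
  refine ⟨?_, fun i j hij => Or.inl (Matrix.diagonal_apply_ne _ hij.ne), fun i => ?_⟩
  · refine Matrix.isHermitian_diagonal_of_self_adjoint _ ?_
    exact funext fun i => Complex.conj_ofReal _
  · rw [Matrix.diagonal_apply_eq, Complex.norm_real, Real.norm_eq_abs]
    rcases lt_trichotomy (x i) 0 with h | h | h
    · right
      rw [abs_of_neg h, Complex.ofReal_neg, div_neg, div_self (by exact_mod_cast h.ne)]
      exact hSb (by simp)
    · left
      simp [h]
    · right
      rw [abs_of_pos h, div_self (by exact_mod_cast h.ne')]
      exact hSb (by simp)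

theorem tendsto_average (ν : ProbabilityMeasure ℝ) :
    ∃ x : ℕ → ℝ, ∀ f : ℝ →ᵇ ℝ, Tendsto (fun n : ℕ => (∑ i ∈ Finset.range n, f (x i)) / (n : ℝ))
      atTop (𝓝 (∫ x, f x ∂(ν : Measure ℝ))) := by
  obtain ⟨x, hx⟩ := exists_tendsto_empirical ν
  refine ⟨x, fun f => ?_⟩
  rw [← tendsto_add_atTop_iff_nat 1]
  refine ((ProbabilityMeasure.tendsto_iff_forall_integral_tendsto.1 hx) f).congr fun n => ?_
  rw [integral_empirical]

theorem ratePhi_le_mul_absMoment {α : ℝ} (hα0 : 0 < α) (hα2 : α < 2) {a b : ℝ≥0∞} (hb : 0 < b)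
    {Sa Sb : Set ℂ} (hSb : {-1, 1} ⊆ Sb) (ν : ProbabilityMeasure ℝ) :
    ratePhi α a b Sa Sb ν ≤ b * absMoment α ν := by
  -- An infinite moment makes the bound trivial, as `b > 0`; otherwise the finiteness required for
  -- `spectral` is available.
  by_cases htop : absMoment α ν = ⊤
  · rw [htop, ENNReal.mul_top hb.ne']
    exact le_top
  obtain ⟨x, hx⟩ := tendsto_average ν
  have hφ : Continuous fun x : ℝ => (x, (0 : ℂ)) := by fun_prop
  let κ : ProbabilityMeasure (ℝ × ℂ) := ν.map hφ.measurable.aemeasurable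
  have hint : ∀ g : ℝ × ℂ → ℝ, Continuous g →
      ∫ p, g p ∂(κ : Measure (ℝ × ℂ)) = ∫ x, g (x, 0) ∂(ν : Measure ℝ) := fun g hg =>
    integral_map hφ.measurable.aemeasurable hg.aestronglyMeasurable
  have hlint : ∀ g : ℝ × ℂ → ℝ≥0∞, Measurable g →
      ∫⁻ p, g p ∂(κ : Measure (ℝ × ℂ)) = ∫⁻ x, g (x, 0) ∂(ν : Measure ℝ) := fun g hg =>
    lintegral_map hg hφ.measurable
  have h1 : ∫⁻ p, ‖p.1‖ₑ ^ α ∂(κ : Measure (ℝ × ℂ)) = absMoment α ν :=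
    hlint _ (measurable_fst.enorm.pow_const α)
  have h2 : ∫⁻ p, ‖p.2‖ₑ ^ α ∂(κ : Measure (ℝ × ℂ)) = 0 := by
    rw [hlint _ (measurable_snd.enorm.pow_const α)]
    simp [hα0]
  have hs : IsAdmissibleSofic Sa Sb (twoPointLaw κ) := by
    refine isAdmissibleSofic_twoPointLaw
      (fun n => Matrix.diagonal fun i : Fin (n + 1) => (x i : ℂ))
      (fun n => diagonal_mem_admissible hSb fun i : Fin (n + 1) => x i)
      (fun n v => (x v, 0)) (fun n v => ?_) (fun g => ?_)
    · have e : (Network.ofMatrix (Matrix.diagonal fun i : Fin (n + 1) => (x i : ℂ))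
          (diagonal_mem_admissible (Sa := Sa) hSb fun i : Fin (n + 1) => x i).1).ω v v = x v :=
        Matrix.diagonal_apply_eq _ _
      rw [component_iso_single _ v fun u hu => Matrix.diagonal_apply_ne _ hu.symm, e,
        Complex.ofReal_re]
    · rw [hint g g.continuous]
      refine ((tendsto_add_atTop_iff_nat 1).2 (hx (g.compContinuous ⟨_, hφ⟩))).congr fun n => ?_
      rw [Finset.sum_range]
      rfl
  refine (ratePhi_le_of_twoPointLaw hα0 hα2 hs (fun f => ?_) (h1 ▸ htop) (by simp [h2])).trans ?_
  · have hc : Continuous fun p : ℝ × ℂ => (f (p.1 + ‖p.2‖) + f (p.1 - ‖p.2‖)) / 2 := by fun_prop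
    rw [hint _ hc]
    simp
  · rw [h1, h2, mul_zero, add_zero]

/-! ### Matrices with two by two off-diagonal blocks -/

theorem sum_range_two_mul (d : ℕ → ℝ) (k : ℕ) :
    ∑ i ∈ Finset.range (2 * k), d i = ∑ i ∈ Finset.range k, (d (2 * i) + d (2 * i + 1)) := by
  induction k with
  | zero => simp
  | succ k ih =>
    rw [Nat.mul_succ, Finset.sum_range_succ, Finset.sum_range_succ, ih, Finset.sum_range_succ]
    ring

theorem tendsto_half_div : Tendsto (fun n : ℕ => ((n / 2 : ℕ) : ℝ) / n) atTop (𝓝 (1 / 2)) := by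
  have h1 : Tendsto (fun n : ℕ => (1 : ℝ) / 2 - (1 : ℝ) / n) atTop (𝓝 (1 / 2)) := by
    simpa using (tendsto_const_nhds (x := (1 : ℝ) / 2)).sub
      (tendsto_one_div_atTop_nhds_zero_nat (𝕜 := ℝ))
  refine tendsto_of_tendsto_of_tendsto_of_le_of_le' h1 tendsto_const_nhds ?_ ?_ <;>
    filter_upwards [eventually_gt_atTop 0] with n hn <;>
    have hn' : (0 : ℝ) < n := by exact_mod_cast hn
  · have h2 : (n : ℝ) ≤ 2 * ((n / 2 : ℕ) : ℝ) + 1 := by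
      have : n ≤ 2 * (n / 2) + 1 := by omega
      exact_mod_cast this
    rw [div_sub_div _ _ two_ne_zero hn'.ne', div_le_div_iff₀ (by positivity) hn']
    nlinarith
  · have h2 : 2 * ((n / 2 : ℕ) : ℝ) ≤ n := by
      have : 2 * (n / 2) ≤ n := by omega
      exact_mod_cast this
    rw [div_le_div_iff₀ hn' two_pos]
    linarith

/-- The hermitian matrix with off-diagonal blocks of entries `z * y i` and `conj z * y i`. -/
noncomputable def pairMatrix (z : ℂ) (y : ℕ → ℝ) (n : ℕ) : Matrix (Fin n) (Fin n) ℂ :=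
  fun i j =>
    if (j : ℕ) = i + 1 ∧ (i : ℕ) % 2 = 0 then z * y (i / 2)
    else if (i : ℕ) = j + 1 ∧ (j : ℕ) % 2 = 0 then (starRingEnd ℂ) z * y (j / 2)
    else 0

theorem isHermitian_pairMatrix (z : ℂ) (y : ℕ → ℝ) (n : ℕ) : (pairMatrix z y n).IsHermitian := by
  refine Matrix.IsHermitian.ext fun i j => ?_
  unfold pairMatrix
  by_cases h1 : (j : ℕ) = i + 1 ∧ (i : ℕ) % 2 = 0
  · have h2 : ¬ ((i : ℕ) = j + 1 ∧ (j : ℕ) % 2 = 0) := by omega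
    rw [if_neg h2, if_pos h1, if_pos h1]
    simp
  · by_cases h2 : (i : ℕ) = j + 1 ∧ (j : ℕ) % 2 = 0
    · rw [if_pos h2, if_neg h1, if_pos h2]
      simp
    · rw [if_neg h1, if_neg h2, if_neg h1, if_neg h2]
      simp

theorem pairMatrix_mem_admissible {Sa Sb : Set ℂ} {z : ℂ} (hz : z ∈ Sa) (hz1 : ‖z‖ = 1)
    {y : ℕ → ℝ} (hy : ∀ i, 0 ≤ y i) (n : ℕ) : pairMatrix z y n ∈ admissible Sa Sb n := by
  refine ⟨isHermitian_pairMatrix z y n, fun i j hij => ?_, fun i => Or.inl ?_⟩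
  · have hij' : (i : ℕ) < j := hij
    unfold pairMatrix
    by_cases h1 : (j : ℕ) = i + 1 ∧ (i : ℕ) % 2 = 0
    · rw [if_pos h1, norm_mul, hz1, one_mul, Complex.norm_real, Real.norm_of_nonneg (hy _)]
      by_cases h0 : y (i / 2) = 0
      · left
        simp [h0]
      · right
        rwa [mul_div_assoc, div_self (by exact_mod_cast h0), mul_one]
    · left
      rw [if_neg h1, if_neg (by omega)]
  · unfold pairMatrix
    rw [if_neg (by omega), if_neg (by omega)]

/-- The edge weight seen from the vertex `v` of `pairMatrix z y n`. -/
noncomputable def pairWeight (z : ℂ) (y : ℕ → ℝ) (n v : ℕ) : ℂ :=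
  if v % 2 = 0 then if v + 1 < n then z * y (v / 2) else 0 else (starRingEnd ℂ) z * y (v / 2)

theorem component_pairMatrix (z : ℂ) (y : ℕ → ℝ) (n : ℕ) (v : Fin n) :
    GStar.mk ((Network.ofMatrix (pairMatrix z y n) (isHermitian_pairMatrix z y n)).component v) =
      twoPointClass (0, pairWeight z y n v) := by
  have hdiag : ∀ i, (Network.ofMatrix (pairMatrix z y n) (isHermitian_pairMatrix z y n)).ω i i =
      0 := by
    intro i
    change pairMatrix z y n i i = 0
    unfold pairMatrix
    rw [if_neg (by omega), if_neg (by omega)]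
  have hzero : ∀ i j : Fin n, ¬ ((j : ℕ) = i + 1 ∧ (i : ℕ) % 2 = 0) →
      ¬ ((i : ℕ) = j + 1 ∧ (j : ℕ) % 2 = 0) →
      (Network.ofMatrix (pairMatrix z y n) (isHermitian_pairMatrix z y n)).ω i j = 0 := by
    intro i j h1 h2
    change pairMatrix z y n i j = 0
    unfold pairMatrix
    rw [if_neg h1, if_neg h2]
  by_cases hv : (v : ℕ) % 2 = 0
  · by_cases hvn : (v : ℕ) + 1 < n
    · let u : Fin n := ⟨v + 1, hvn⟩
      have hu : (u : ℕ) = v + 1 := rfl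
      have hvu : v ≠ u := fun h => by
        have := congrArg Fin.val h
        omega
      rw [component_iso_pair _ hvu (by rw [hdiag, hdiag])
        (fun x h1 h2 => hzero _ _ (fun h => h2 (Fin.ext (by omega))) (by omega))
        (fun x h1 h2 => hzero _ _ (by omega) (fun h => h1 (Fin.ext (by omega)))), hdiag]
      have hw : (Network.ofMatrix (pairMatrix z y n) (isHermitian_pairMatrix z y n)).ω v u =
          pairWeight z y n v := by
        change pairMatrix z y n v u = _
        unfold pairMatrix pairWeight
        rw [if_pos ⟨hu, hv⟩, if_pos hv, if_pos hvn]
      rw [hw, Complex.zero_re]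
    · rw [component_iso_single _ v fun x hx => hzero _ _ (by omega) (by omega), hdiag,
        pairWeight, if_pos hv, if_neg hvn, Complex.zero_re]
  · let u : Fin n := ⟨v - 1, by omega⟩
    have hu : (u : ℕ) = v - 1 := rfl
    have hvu : v ≠ u := fun h => by
      have := congrArg Fin.val h
      omega
    rw [component_iso_pair _ hvu (by rw [hdiag, hdiag])
      (fun x h1 h2 => hzero _ _ (by omega) (fun h => h2 (Fin.ext (by omega))))
      (fun x h1 h2 => hzero _ _ (fun h => h1 (Fin.ext (by omega))) (by omega)), hdiag]
    have hw : (Network.ofMatrix (pairMatrix z y n) (isHermitian_pairMatrix z y n)).ω v u =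
        pairWeight z y n v := by
      change pairMatrix z y n v u = _
      have h2 : (u : ℕ) / 2 = v / 2 := by omega
      unfold pairMatrix pairWeight
      rw [if_neg (by omega), if_pos (by omega), if_neg hv, h2]
    rw [hw, Complex.zero_re]

theorem sum_pairWeight (z : ℂ) (y : ℕ → ℝ) (n : ℕ) (g : ℂ → ℝ) :
    ∑ v : Fin n, g (pairWeight z y n v) =
      ∑ i ∈ Finset.range (n / 2), (g (z * y i) + g ((starRingEnd ℂ) z * y i)) +
        if n % 2 = 0 then 0 else g 0 := by
  rw [← Finset.sum_range fun v => g (pairWeight z y n v)]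
  have hsum : ∑ v ∈ Finset.range (2 * (n / 2)), g (pairWeight z y n v) =
      ∑ i ∈ Finset.range (n / 2), (g (z * y i) + g ((starRingEnd ℂ) z * y i)) := by
    rw [sum_range_two_mul]
    refine Finset.sum_congr rfl fun i hi => ?_
    have hi' := Finset.mem_range.1 hi
    have e1 : 2 * i / 2 = i := by omega
    have e2 : (2 * i + 1) / 2 = i := by omega
    rw [pairWeight, pairWeight, if_pos (by omega), if_pos (by omega), if_neg (by omega), e1, e2]
  by_cases h : n % 2 = 0
  · have hn : 2 * (n / 2) = n := by omega
    rw [hn] at hsum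
    rw [if_pos h, add_zero, hsum]
  · have hn : n = 2 * (n / 2) + 1 := by omega
    -- For odd `n` the last vertex has no partner and contributes the weight zero.
    have h0 : pairWeight z y n (2 * (n / 2)) = 0 := by
      rw [pairWeight, if_pos (by omega), if_neg (by omega)]
    rw [if_neg h, ← hsum, ← h0, ← Finset.sum_range_succ (fun v => g (pairWeight z y n v)), ← hn]

theorem ratePhi_le_half_mul_absMoment {α : ℝ} (hα0 : 0 < α) (hα2 : α < 2) {a b : ℝ≥0∞}
    (ha : 0 < a) {Sa Sb : Set ℂ} {z : ℂ} (hz : z ∈ Sa) (hz1 : ‖z‖ = 1) (ν : ProbabilityMeasure ℝ)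
    (hν : (ν : Measure ℝ).map (fun x => -x) = (ν : Measure ℝ)) :
    ratePhi α a b Sa Sb ν ≤ a / 2 * absMoment α ν := by
  by_cases htop : absMoment α ν = ⊤
  · rw [htop, ENNReal.mul_top (by simp [ha.ne'])]
    exact le_top
  obtain ⟨x, hx⟩ := tendsto_average ν
  have hφ : ∀ z : ℂ, Continuous fun x : ℝ => ((0 : ℝ), z * (|x| : ℝ)) := fun z => by fun_prop
  let z' := (starRingEnd ℂ) z
  have hz1' : ‖z'‖ = 1 := (RCLike.norm_conj z).trans hz1
  let μ : ℂ → Measure (ℝ × ℂ) := fun z => (ν : Measure ℝ).map fun x => (0, z * (|x| : ℝ))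
  have hμ : ∀ z, IsProbabilityMeasure (μ z) := fun z =>
    Measure.isProbabilityMeasure_map (hφ z).measurable.aemeasurable
  -- Even vertices see the edge weight `z|x|` and odd ones its conjugate, which need not be
  -- isomorphic as rooted classes; hence the mixture.
  let κ : ProbabilityMeasure (ℝ × ℂ) := ⟨(2 : ℝ≥0∞)⁻¹ • (μ z + μ z'), ⟨by
    simp only [Measure.smul_apply, Measure.add_apply, measure_univ, smul_eq_mul,
      one_add_one_eq_two]
    exact ENNReal.inv_mul_cancel (by simp) (by simp)⟩⟩
  have hint : ∀ g : (ℝ × ℂ) →ᵇ ℝ, ∫ p, g p ∂(κ : Measure (ℝ × ℂ)) =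
      (∫ x, (g (0, z * (|x| : ℝ)) + g (0, z' * (|x| : ℝ))) ∂(ν : Measure ℝ)) / 2 := by
    intro g
    change ∫ p, g p ∂((2 : ℝ≥0∞)⁻¹ • (μ z + μ z')) = _
    have hi : ∀ z, Integrable (fun x : ℝ => g (0, z * (|x| : ℝ))) (ν : Measure ℝ) := fun z =>
      (g.compContinuous ⟨_, hφ z⟩).integrable _
    rw [integral_smul_measure, integral_add_measure (g.integrable _) (g.integrable _),
      integral_map (hφ z).measurable.aemeasurable g.continuous.aestronglyMeasurable,
      integral_map (hφ z').measurable.aemeasurable g.continuous.aestronglyMeasurable,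
      integral_add (hi z) (hi z')]
    simp [div_eq_inv_mul]
  have hlint : ∀ g : ℝ × ℂ → ℝ≥0∞, Measurable g → ∫⁻ p, g p ∂(κ : Measure (ℝ × ℂ)) =
      2⁻¹ * (∫⁻ x, g (0, z * (|x| : ℝ)) ∂(ν : Measure ℝ) +
        ∫⁻ x, g (0, z' * (|x| : ℝ)) ∂(ν : Measure ℝ)) := by
    intro g hg
    change ∫⁻ p, g p ∂((2 : ℝ≥0∞)⁻¹ • (μ z + μ z')) = _
    rw [lintegral_smul_measure, lintegral_add_measure, lintegral_map hg (hφ z).measurable,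
      lintegral_map hg (hφ z').measurable, smul_eq_mul]
  have h1 : ∫⁻ p, ‖p.1‖ₑ ^ α ∂(κ : Measure (ℝ × ℂ)) = 0 := by
    rw [hlint _ (measurable_fst.enorm.pow_const α)]
    simp [hα0]
  have hnorm : ∀ {z : ℂ} (x : ℝ), ‖z‖ = 1 → ‖z * (|x| : ℝ)‖ = |x| := fun x hz => by
    rw [norm_mul, hz, one_mul, Complex.norm_real, Real.norm_eq_abs, abs_abs]
  have henorm : ∀ {z : ℂ} (x : ℝ), ‖z‖ = 1 → ‖z * (|x| : ℝ)‖ₑ = ‖x‖ₑ := fun x hz => by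
    rw [← ofReal_norm, hnorm x hz, Real.enorm_eq_ofReal_abs]
  have h2 : ∫⁻ p, ‖p.2‖ₑ ^ α ∂(κ : Measure (ℝ × ℂ)) = absMoment α ν := by
    rw [hlint _ (measurable_snd.enorm.pow_const α)]
    simp only [henorm _ hz1, henorm _ hz1']
    rw [← two_mul, ← mul_assoc, ENNReal.inv_mul_cancel (by simp) (by simp), one_mul]
    rfl
  have hs : IsAdmissibleSofic Sa Sb (twoPointLaw κ) := by
    refine isAdmissibleSofic_twoPointLaw (fun n => pairMatrix z (fun i => |x i|) (n + 1))
      (fun n => pairMatrix_mem_admissible hz hz1 (fun i => abs_nonneg (x i)) (n + 1))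
      (fun n v => (0, pairWeight z (fun i => |x i|) (n + 1) v))
      (fun n v => component_pairMatrix z _ (n + 1) v) (fun g => ?_)
    have hlim := hx (g.compContinuous ⟨_, hφ z⟩ + g.compContinuous ⟨_, hφ z'⟩)
    -- There are `n/2` blocks among `n` vertices: the average over blocks is rescaled by a factor
    -- tending to `1/2`.
    have hlim2 := (hlim.comp (Nat.tendsto_div_const_atTop two_ne_zero)).mul tendsto_half_div
    have herr : Tendsto (fun n : ℕ => (if n % 2 = 0 then 0 else g (0, 0)) / (n : ℝ)) atTop
        (𝓝 0) := by
      refine squeeze_zero_norm (fun n => ?_) (tendsto_const_div_atTop_nhds_zero_nat ‖g (0, 0)‖)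
      rw [norm_div, Real.norm_natCast]
      refine div_le_div_of_nonneg_right ?_ (Nat.cast_nonneg n)
      split_ifs <;> simp
    have hfin := (tendsto_add_atTop_iff_nat 1).2 (hlim2.add herr)
    rw [add_zero, mul_one_div] at hfin
    rw [hint]
    refine hfin.congr fun n => ?_
    rw [sum_pairWeight z (fun i => |x i|) (n + 1) fun w => g (0, w), add_div]
    congr 1
    rw [Function.comp_apply]
    by_cases h0 : (n + 1) / 2 = 0
    · simp [h0]
    · rw [div_mul_div_cancel₀ (by exact_mod_cast h0)]
      rfl
  refine (ratePhi_le_of_twoPointLaw hα0 hα2 hs (fun f => ?_) (by simp [h1]) (h2 ▸ htop)).trans ?_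
  · let g : (ℝ × ℂ) →ᵇ ℝ := (2⁻¹ : ℝ) •
      (f.compContinuous ⟨fun p : ℝ × ℂ => p.1 + ‖p.2‖, by fun_prop⟩ +
        f.compContinuous ⟨fun p : ℝ × ℂ => p.1 - ‖p.2‖, by fun_prop⟩)
    have hg : ∀ p, g p = (f (p.1 + ‖p.2‖) + f (p.1 - ‖p.2‖)) / 2 := fun p => by
      rw [div_eq_inv_mul]
      rfl
    have hsymm : ∫ x, f (-x) ∂(ν : Measure ℝ) = ∫ x, f x ∂(ν : Measure ℝ) := by
      conv_rhs => rw [← hν]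
      rw [integral_map measurable_neg.aemeasurable f.continuous.aestronglyMeasurable]
    -- The eigenvalues `±|x|` are `x` and `-x` in some order; symmetry of `ν` then merges the two
    -- integrals.
    have hpt : ∀ x : ℝ, g (0, z * (|x| : ℝ)) + g (0, z' * (|x| : ℝ)) = f x + f (-x) := by
      intro x
      rw [hg, hg, hnorm x hz1, hnorm x hz1']
      rcases abs_cases x with ⟨h, -⟩ | ⟨h, -⟩ <;> (simp [h]; try ring)
    have hneg : Integrable (fun x => f (-x)) (ν : Measure ℝ) :=
      (f.compContinuous ⟨fun x : ℝ => -x, by fun_prop⟩).integrable _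
    simp only [← hg]
    rw [hint, integral_congr_ae (ae_of_all _ hpt), integral_add (f.integrable _) hneg, hsymm]
    ring
  · rw [h1, h2, mul_zero, zero_add]

end WignerLDP

theorem theorem1p2 {Ω : Type*} [MeasurableSpace Ω] (P : Measure Ω) [IsProbabilityMeasure P]
    (X₁₂ : Ω → ℂ) (X₁₁ : Ω → ℝ) (hX₁₂ : Measurable X₁₂) (hX₁₁ : Measurable X₁₁)
    (hvar : ∫ ω, ‖X₁₂ ω - ∫ ω', X₁₂ ω' ∂P‖ ^ 2 ∂P = 1)
    (α : ℝ) (hα0 : 0 < α) (hα2 : α < 2)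
    (a b : ℝ≥0∞) (ha : 0 < a) (hb : 0 < b)
    (ϑa ϑb : Measure ℂ) [IsProbabilityMeasure ϑa] [IsProbabilityMeasure ϑb]
    (hϑa : ϑa (Metric.sphere 0 1) = 1) (hϑb : ϑb (Metric.sphere 0 1) = 1)
    (hXa : TailClass P α a ϑa X₁₂) (hXb : TailClass P α b ϑb (fun ω => (X₁₁ ω : ℂ))) :
    (∀ ν : ProbabilityMeasure ℝ,
      min (a / 2) b * absMoment α ν ≤ ratePhi α a b ϑa.support ϑb.support ν) ∧
    (ϑb.support = {-1, 1} → ∀ ν : ProbabilityMeasure ℝ,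
      ratePhi α a b ϑa.support ϑb.support ν ≤ b * absMoment α ν) ∧
    (ϑb.support = {-1, 1} → ∀ ν : ProbabilityMeasure ℝ,
      (ν : Measure ℝ).map (fun x => -x) = (ν : Measure ℝ) →
      ratePhi α a b ϑa.support ϑb.support ν = min (a / 2) b * absMoment α ν) := by
  have hlow := min_mul_absMoment_le_ratePhi hα0 hα2.le a b ϑa.support ϑb.support
  refine ⟨hlow, fun hSb ν => ratePhi_le_mul_absMoment hα0 hα2 hb hSb.ge ν,
    fun hSb ν hν => le_antisymm ?_ (hlow ν)⟩
  rcases le_total (a / 2) b with h | h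
  · rw [min_eq_left h]
    -- Any point of the support serves as the common phase. It has modulus one because the circle is
    -- closed and has full measure.
    obtain ⟨z, hz⟩ := Measure.nonempty_support (IsProbabilityMeasure.ne_zero ϑa)
    have hz1 : z ∈ Metric.sphere (0 : ℂ) 1 :=
      Measure.support_subset_of_isClosed Metric.isClosed_sphere
        ((prob_compl_eq_zero_iff Metric.isClosed_sphere.measurableSet).2 hϑa) hz
    exact ratePhi_le_half_mul_absMoment hα0 hα2 ha hz (by simpa using hz1) ν hν
  · rw [min_eq_right h]
    exact ratePhi_le_mul_absMoment hα0 hα2 hb hSb.ge ν
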